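/- Let $O=(0,0)$, $A_1=(1,0)$, $A_2=(\tfrac32,\tfrac{\sqrt3}2)$, $A_3=(1,\sqrt3)$, $A_4=(0,\sqrt3)$, $A_5=(-\tfrac12,\tfrac{\sqrt3}2)$ be the vertices of a regular hexagon $H\subset\mathbb R^2$ (a closed solid region) of side length $1$, put $A_0=O$, let $L$ be the boundary of $H$, and let $P$ be the uniform distribution on $L$, that is, the probability measure on $L$ with density $\tfrac16$ with respect to arc length. For $n\ge 1$, an optimal set of $n$-means for $P$ is a finite set $\alpha\subset\mathbb R^2$ with at most $n$ points that attains the infimum $$V_n(P)=\inf\Big\{\int\min_{a\in\beta}\|x-a\|^2\,dP(x)\;:\;\beta\subset\mathbb R^2,\ \operatorname{card}(\beta)\le n\Big\}.$$ Then, for all sufficiently large $n$, every optimal set $\alpha$ of $n$-means for $P$ contains six distinct points $c_0(\alpha),\dots,c_5(\alpha)$ (its corner points) that lie in the interior of $H$, and all other points of $\alpha$ lie on $L$. Moreover, the corner points can be labelled so that, for each $i\in\{0,\dots,5\}$, $c_i(\alpha)\to A_i$ as $n\to\infty$, uniformly over all optimal sets $\alpha$ of $n$-means: for every $\varepsilon>0$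 there is $M$ such that $\|c_i(\alpha)-A_i\|<\varepsilon$ for all $n\ge M$, all optimal sets $\alpha$ of $n$-means, and all $i$. -/

import Mathlib

open MeasureTheory Filter Topology

namespace HexQuant

/-- The Euclidean plane. -/
abbrev Plane : Type := EuclideanSpace ℝ (Fin 2)

/-- The vertices `O, A₁, A₂, A₃, A₄, A₅` of the regular hexagon with side length one, listed
counterclockwise. -/
noncomputable def vertex : Fin 6 → Plane :=
  ![!₂[0, 0], !₂[1, 0], !₂[3 / 2, √3 / 2], !₂[1, √3], !₂[0, √3], !₂[-1 / 2, √3 / 2]]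

/-- The boundary `L` of the hexagon: the union of its six sides. The index `j + 1` is taken in
`Fin 6`, so that the last side joins `A₅` to `O`. -/
def boundary : Set Plane :=
  ⋃ j : Fin 6, segment ℝ (vertex j) (vertex (j + 1))

/-- The (solid, closed) hexagonal region. -/
def region : Set Plane :=
  convexHull ℝ (Set.range vertex)

/-- The uniform distribution on the boundary of the hexagon: each side has length one and is
parametrized by arc length `t ∈ [0, 1]`, and the density with respect to arc length is `1 / 6`. -/
noncomputable def uniformDist : Measure Plane :=
  (6 : ENNReal)⁻¹ • ∑ j : Fin 6,
    (volume.restrict (Set.Icc (0 : ℝ) 1)).map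
      (fun t : ℝ => AffineMap.lineMap (vertex j) (vertex (j + 1)) t)

/-- The distortion error `∫ min_{a ∈ α} ‖x - a‖² dP(x)` of a finite set `α`, with value in
`[0, ∞]`; it is `∞` for `α = ∅` when `P ≠ 0`. -/
noncomputable def distortion (P : Measure Plane) (α : Finset Plane) : ENNReal :=
  ∫⁻ x, ⨅ a ∈ α, edist x a ^ 2 ∂P

/-- The `n`th quantization error `V_n(P)`. -/
noncomputable def quantizationError (P : Measure Plane) (n : ℕ) : ENNReal :=
  ⨅ (α : Finset Plane) (_ : α.card ≤ n), distortion P α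

/-- `α` is an optimal set of `n`-means for `P`: it has at most `n` points and attains the
infimum that defines the `n`th quantization error. -/
def IsOptimalMeans (P : Measure Plane) (n : ℕ) (α : Finset Plane) : Prop :=
  α.card ≤ n ∧ distortion P α = quantizationError P n

end HexQuant

/-!
Each point `a` of an optimal set `α` serves a cell, the part of the boundary that is sent to `a` by
a nearest-point map. For large `n` all cells are small, so that a cell meets one side of the
hexagon or two adjacent sides. Replacing `a` by another point cannot decrease the cost. If the cell
of `a` lies on one side, then `a` is the mean of its cell and therefore belongs to that side. If it
meets two sides, then `a` is a proper weighted average of the means `P₁` and `P₂` of the two parts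
of the cell, and hence lies in the interior of the hexagon and close to the vertex.

At most one point serves both sides at a vertex `V`. Indeed, any other point `d` of `α` could be
used in place of `a` on one of the two parts of the cell, which keeps `d` out of the parallelogram
spanned by the segments `V P₁` and `V P₂`, because `P₁ P₂` is seen from its points at an obtuse
angle. The remaining positions of `d` violate the convexity of Voronoi cells.

If no point serves both sides at `V`, then these sides cost at least
`∑ (length)³ / (12 (number of points)²)`. This can be beaten: with `l` the smaller of the two
average cell lengths, give up one cell of length `l` and let a corner point take over an arm of
length `l / 2` on each side of `V`.
-/

namespace HexQuant

section InnerProductSpace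

variable {E : Type*} [NormedAddCommGroup E] [InnerProductSpace ℝ E]

lemma dist_sq_lineMap (x y b : E) (θ : ℝ) :
    dist (AffineMap.lineMap x y θ) b ^ 2
      = (1 - θ) * dist x b ^ 2 + θ * dist y b ^ 2 - θ * (1 - θ) * dist x y ^ 2 := by
  have hpoint : AffineMap.lineMap x y θ - b = (1 - θ) • (x - b) + θ • (y - b) := by
    rw [AffineMap.lineMap_apply_module]; module
  have hside : x - y = (x - b) - (y - b) := by abel
  rw [dist_eq_norm, dist_eq_norm, dist_eq_norm, dist_eq_norm, hpoint, hside, norm_add_sq_real,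
    norm_sub_sq_real (x - b), norm_smul, norm_smul, inner_smul_left, inner_smul_right, mul_pow,
    mul_pow, Real.norm_eq_abs, Real.norm_eq_abs, sq_abs, sq_abs, conj_trivial]
  ring

lemma add_mul_dist_sq_lineMap (x y b : E) {w₁ w₂ : ℝ} (hw : w₁ + w₂ ≠ 0) :
    (w₁ + w₂) * dist (AffineMap.lineMap x y (w₂ / (w₁ + w₂))) b ^ 2
        + w₁ * w₂ / (w₁ + w₂) * dist x y ^ 2
      = w₁ * dist x b ^ 2 + w₂ * dist y b ^ 2 := by
  rw [dist_sq_lineMap]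
  field_simp
  ring

lemma dist_le_of_mem_segment {x y p b d : E} (hx : dist x b ≤ dist x d) (hy : dist y b ≤ dist y d)
    (hp : p ∈ segment ℝ x y) : dist p b ≤ dist p d := by
  rw [segment_eq_image_lineMap] at hp
  obtain ⟨θ, ⟨hθ0, hθ1⟩, rfl⟩ := hp
  rw [← sq_le_sq₀ dist_nonneg dist_nonneg, dist_sq_lineMap, dist_sq_lineMap]
  have hx' := mul_le_mul_of_nonneg_left (pow_le_pow_left₀ dist_nonneg hx 2) (sub_nonneg.2 hθ1)
  have hy' := mul_le_mul_of_nonneg_left (pow_le_pow_left₀ dist_nonneg hy 2) hθ0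
  linarith

lemma dist_lt_of_mem_segment {x y p b d : E} (hx : dist x b < dist x d) (hy : dist y b ≤ dist y d)
    (hp : p ∈ segment ℝ x y) (hpy : p ≠ y) : dist p b < dist p d := by
  rw [segment_eq_image_lineMap] at hp
  obtain ⟨θ, ⟨hθ0, hθ1⟩, rfl⟩ := hp
  have hθ : θ < 1 := hθ1.lt_of_ne fun h => hpy (by rw [h, AffineMap.lineMap_apply_one])
  rw [← sq_lt_sq₀ dist_nonneg dist_nonneg, dist_sq_lineMap, dist_sq_lineMap]
  have hx' := mul_lt_mul_of_pos_left (pow_lt_pow_left₀ hx dist_nonneg two_ne_zero)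
    (sub_pos.2 hθ)
  have hy' := mul_le_mul_of_nonneg_left (pow_le_pow_left₀ dist_nonneg hy 2) hθ0
  linarith

lemma dist_sq_affineIsometry (γ : ℝ →ᵃⁱ[ℝ] E) (p : E) (m t : ℝ) :
    dist (γ t) p ^ 2
      = (t - m) ^ 2 + 2 * inner ℝ (γ.linear 1) (γ m - p) * (t - m) + dist (γ m) p ^ 2 := by
  have hlin : γ t - γ m = (t - m) • γ.linear 1 := by
    rw [← map_smul, smul_eq_mul, mul_one]
    exact (γ.toAffineMap.linearMap_vsub t m).symm
  have hnorm : ‖γ t - γ m‖ ^ 2 = (t - m) ^ 2 := by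
    rw [← dist_eq_norm, γ.dist_map, Real.dist_eq, sq_abs]
  rw [dist_eq_norm, dist_eq_norm, ← sub_add_sub_cancel (γ t) (γ m) p, norm_add_sq_real, hnorm,
    hlin, inner_smul_left, conj_trivial]
  ring

lemma exists_abs_sub_le_dist_affineIsometry (γ : ℝ →ᵃⁱ[ℝ] E) (p : E) :
    ∃ c : ℝ, ∀ t, |t - c| ≤ dist (γ t) p := by
  set κ := inner ℝ (γ.linear 1) (γ 0 - p)
  refine ⟨-κ, fun t => abs_le_of_sq_le_sq ?_ dist_nonneg⟩
  have hunit : ‖γ.linear 1‖ = 1 := by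
    have h := γ.linearIsometry.norm_map 1
    rwa [norm_one] at h
  have hκ : κ ^ 2 ≤ dist (γ 0) p ^ 2 := by
    have h := abs_real_inner_le_norm (γ.linear 1) (γ 0 - p)
    rw [hunit, one_mul, ← dist_eq_norm] at h
    exact sq_le_sq' (abs_le.1 h).1 (abs_le.1 h).2
  rw [dist_sq_affineIsometry γ p 0 t]
  linarith

end InnerProductSpace

section IntegralOnBoundedSets

lemma integrableOn_of_isBounded {f : ℝ → ℝ} (hf : Continuous f) {s : Set ℝ}
    (hs : Bornology.IsBounded s) : IntegrableOn f s :=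
  (hf.locallyIntegrable.integrableOn_isCompact hs.isCompact_closure).mono_set subset_closure

variable {E : Type*} [NormedAddCommGroup E] [InnerProductSpace ℝ E]

lemma setIntegral_dist_sq_affineIsometry (γ : ℝ →ᵃⁱ[ℝ] E) {s : Set ℝ}
    (hs : Bornology.IsBounded s) (p : E) :
    ∫ t in s, dist (γ t) p ^ 2
      = (∫ t in s, (t - ⨍ u in s, u) ^ 2) + volume.real s * dist (γ (⨍ u in s, u)) p ^ 2 := by
  set m := ⨍ u in s, u
  have hfin : volume s ≠ ⊤ := hs.measure_lt_top.ne
  have hcentered : ∫ t in s, (t - m) = 0 := by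
    have : IsFiniteMeasure (volume.restrict s) := isFiniteMeasure_restrict.2 hfin
    exact integral_sub_average (volume.restrict s) fun t => t
  have hint : ∀ {f : ℝ → ℝ}, Continuous f → IntegrableOn f s := fun hf =>
    integrableOn_of_isBounded hf hs
  rw [show (fun t => dist (γ t) p ^ 2) = _ from funext (dist_sq_affineIsometry γ p m),
    integral_add (hint (by fun_prop)) (hint continuous_const),
    integral_add (hint (by fun_prop)) (hint (by fun_prop)), integral_const_mul, hcentered,
    setIntegral_const, smul_eq_mul]
  ring

lemma integral_sq_sub_sub_sq (c : ℝ) {r : ℝ} (hr : 0 ≤ r) :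
    ∫ t in Set.Icc (c - r) (c + r), (r ^ 2 - (t - c) ^ 2) = 4 * r ^ 3 / 3 := by
  rw [integral_Icc_eq_integral_Ioc, ← intervalIntegral.integral_of_le (by linarith),
    intervalIntegral.integral_comp_sub_right (fun x => r ^ 2 - x ^ 2),
    intervalIntegral.integral_sub (by simp) (intervalIntegral.intervalIntegrable_pow 2),
    intervalIntegral.integral_const, integral_pow, smul_eq_mul]
  push_cast
  ring

lemma le_setIntegral_sub_sq {s : Set ℝ} (hs : Bornology.IsBounded s) (c : ℝ) {r : ℝ}
    (hr : 0 ≤ r) : r ^ 2 * volume.real s - 4 * r ^ 3 / 3 ≤ ∫ t in s, (t - c) ^ 2 := by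
  set J := Set.Icc (c - r) (c + r)
  set f : ℝ → ℝ := fun t => r ^ 2 - (t - c) ^ 2
  have hf : Continuous f := by fun_prop
  have hle_indicator : ∀ t, f t ≤ J.indicator f t := fun t => by
    by_cases ht : t ∈ J
    · rw [Set.indicator_of_mem ht]
    · rw [Set.indicator_of_notMem ht]
      contrapose! ht
      have habs := abs_le.1 (abs_le_of_sq_le_sq (sub_pos.1 ht).le hr)
      exact ⟨by linarith, by linarith⟩
  have hnonneg : ∀ t ∈ J, 0 ≤ f t := fun t ht =>
    sub_nonneg.2 (sq_le_sq' (by linarith [ht.1]) (by linarith [ht.2]))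
  have hfJ : IntegrableOn f J := hf.integrableOn_Icc
  have hupper : ∫ t in s, f t ≤ 4 * r ^ 3 / 3 :=
    calc ∫ t in s, f t
        ≤ ∫ t in s, J.indicator f t :=
          integral_mono (integrableOn_of_isBounded hf hs)
            ((hfJ.integrable_indicator measurableSet_Icc).integrableOn) hle_indicator
      _ = ∫ t in s ∩ J, f t := setIntegral_indicator measurableSet_Icc
      _ ≤ ∫ t in J, f t :=
          setIntegral_mono_set hfJ
            ((ae_restrict_iff' measurableSet_Icc).2 (Eventually.of_forall hnonneg))
            (Eventually.of_forall Set.inter_subset_right)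
      _ = 4 * r ^ 3 / 3 := integral_sq_sub_sub_sq c hr
  have hsplit : ∫ t in s, f t = r ^ 2 * volume.real s - ∫ t in s, (t - c) ^ 2 := by
    rw [integral_sub (integrableOn_of_isBounded continuous_const hs)
      (integrableOn_of_isBounded (by fun_prop) hs), setIntegral_const, smul_eq_mul, mul_comm]
  linarith

lemma le_setIntegral_dist_sq_affineIsometry (γ : ℝ →ᵃⁱ[ℝ] E) {s : Set ℝ}
    (hs : Bornology.IsBounded s) (p : E) {r : ℝ} (hr : 0 ≤ r) :
    r ^ 2 * volume.real s - 4 * r ^ 3 / 3 ≤ ∫ t in s, dist (γ t) p ^ 2 := by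
  obtain ⟨c, hc⟩ := exists_abs_sub_le_dist_affineIsometry γ p
  have hγ := γ.continuous
  refine (le_setIntegral_sub_sq hs c hr).trans ?_
  refine integral_mono (integrableOn_of_isBounded (by fun_prop) hs)
    (integrableOn_of_isBounded (by fun_prop) hs) fun t => ?_
  exact (sq_abs (t - c)).symm.trans_le (pow_le_pow_left₀ (abs_nonneg _) (hc t) 2)

end IntegralOnBoundedSets

section Quantizer

variable {X : Type*} [PseudoMetricSpace X] [MeasurableSpace X]

/-- The points `γ t` with `t` between `a` and `b` can be sent to points of `S`, in a measurable
way, at the total squared cost `c`. -/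
def HasQuantizer (γ : ℝ → X) (S : Finset X) (a b c : ℝ) : Prop :=
  ∃ g : ℝ → X, Measurable g ∧ (∀ t, g t ∈ S) ∧ ∫ t in a..b, dist (γ t) (g t) ^ 2 = c

lemma hasQuantizer_singleton (γ : ℝ → X) (p : X) (a b : ℝ) :
    HasQuantizer γ {p} a b (∫ t in a..b, dist (γ t) p ^ 2) :=
  ⟨fun _ => p, measurable_const, fun _ => Finset.mem_singleton_self p, rfl⟩

lemma HasQuantizer.comp_one_sub {γ : ℝ → X} {S : Finset X} {a b c : ℝ}
    (h : HasQuantizer γ S a b c) : HasQuantizer (fun t => γ (1 - t)) S (1 - b) (1 - a) c := by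
  obtain ⟨g, hg, hgS, hc⟩ := h
  refine ⟨fun t => g (1 - t), hg.comp (measurable_const.sub measurable_id), fun t => hgS _, ?_⟩
  rw [intervalIntegral.integral_comp_sub_left (fun t => dist (γ t) (g t) ^ 2) 1]
  simpa using hc

variable [SecondCountableTopology X] [BorelSpace X]

lemma integrableOn_dist_sq {γ g : ℝ → X} (hγ : Continuous γ) (hg : Measurable g) {S : Finset X}
    (hgS : ∀ t, g t ∈ S) {s : Set ℝ} (hs : Bornology.IsBounded s) :
    IntegrableOn (fun t => dist (γ t) (g t) ^ 2) s := by
  have hdom : IntegrableOn (fun t => ∑ b ∈ S, dist (γ t) b ^ 2) s :=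
    integrableOn_of_isBounded (by fun_prop) hs
  refine hdom.mono' ((hγ.measurable.dist hg).pow_const 2).aestronglyMeasurable
    (Eventually.of_forall fun t => ?_)
  rw [Real.norm_of_nonneg (sq_nonneg _)]
  exact Finset.single_le_sum (f := fun b => dist (γ t) b ^ 2) (fun _ _ => sq_nonneg _) (hgS t)

lemma HasQuantizer.union [DecidableEq X] {γ : ℝ → X} (hγ : Continuous γ) {S T : Finset X}
    {a b c v w : ℝ} (hS : HasQuantizer γ S a b v) (hT : HasQuantizer γ T b c w) (hab : a ≤ b)
    (hbc : b ≤ c) : HasQuantizer γ (S ∪ T) a c (v + w) := by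
  obtain ⟨f, hf, hfS, rfl⟩ := hS
  obtain ⟨g, hg, hgT, rfl⟩ := hT
  set h : ℝ → X := fun t => if t ≤ b then f t else g t
  have hh : Measurable h := Measurable.ite measurableSet_Iic hf hg
  have hhST : ∀ t, h t ∈ S ∪ T := fun t => by
    by_cases ht : t ≤ b
    · simp only [h, if_pos ht, Finset.mem_union_left T (hfS t)]
    · simp only [h, if_neg ht, Finset.mem_union_right S (hgT t)]
  have hint : ∀ u v, IntervalIntegrable (fun t => dist (γ t) (h t) ^ 2) volume u v := fun u v =>
    intervalIntegrable_iff.2 (integrableOn_dist_sq hγ hh hhST (Metric.isBounded_Ioc _ _))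
  refine ⟨h, hh, hhST, ?_⟩
  rw [← intervalIntegral.integral_add_adjacent_intervals (hint a b) (hint b c)]
  congr 1 <;> refine intervalIntegral.integral_congr_ae (Eventually.of_forall fun t ht => ?_)
  · rw [Set.uIoc_of_le hab] at ht
    simp only [h, if_pos ht.2]
  · rw [Set.uIoc_of_le hbc] at ht
    simp only [h, if_neg ht.1.not_ge]

end Quantizer

section EqualDivision

variable {E : Type*} [NormedAddCommGroup E] [InnerProductSpace ℝ E]

lemma integral_dist_sq_midpoint (γ : ℝ →ᵃⁱ[ℝ] E) (a h : ℝ) :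
    ∫ t in a..a + h, dist (γ t) (γ (a + h / 2)) ^ 2 = h ^ 3 / 12 := by
  simp only [γ.dist_map, Real.dist_eq, sq_abs]
  rw [intervalIntegral.integral_comp_sub_right (fun x => x ^ 2), integral_pow]
  push_cast
  ring

variable [SecondCountableTopology E] [MeasurableSpace E] [BorelSpace E]

lemma exists_hasQuantizer_add_mul (γ : ℝ →ᵃⁱ[ℝ] E) (a : ℝ) {h : ℝ} (hh : 0 ≤ h) (k : ℕ) :
    ∃ S : Finset E, S.card ≤ k + 1 ∧
      HasQuantizer γ S a (a + (k + 1) * h) ((k + 1) * h ^ 3 / 12) := by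
  classical
  induction k with
  | zero =>
    refine ⟨{γ (a + h / 2)}, by simp, ?_⟩
    have hcell := hasQuantizer_singleton γ (γ (a + h / 2)) a (a + h)
    rw [integral_dist_sq_midpoint] at hcell
    simpa using hcell
  | succ k ih =>
    obtain ⟨S, hcard, hS⟩ := ih
    set b := a + (k + 1) * h
    have hab : a ≤ b := le_add_of_nonneg_right (by positivity)
    refine ⟨S ∪ {γ (b + h / 2)}, (Finset.card_union_le _ _).trans (by simpa using hcard), ?_⟩
    have hunion := hS.union γ.continuous (hasQuantizer_singleton γ (γ (b + h / 2)) b (b + h)) hab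
      (le_add_of_nonneg_right hh)
    rw [integral_dist_sq_midpoint] at hunion
    convert hunion using 1 <;> push_cast <;> ring

lemma exists_hasQuantizer_card_le (γ : ℝ →ᵃⁱ[ℝ] E) {a b : ℝ} (hab : a ≤ b) {k : ℕ} (hk : k ≠ 0) :
    ∃ S : Finset E, S.card ≤ k ∧ HasQuantizer γ S a b ((b - a) ^ 3 / (12 * k ^ 2)) := by
  obtain ⟨k, rfl⟩ := Nat.exists_eq_succ_of_ne_zero hk
  obtain ⟨S, hcard, hS⟩ := exists_hasQuantizer_add_mul γ a (h := (b - a) / (k + 1))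
    (div_nonneg (sub_nonneg.2 hab) (by positivity)) k
  refine ⟨S, hcard, ?_⟩
  have hpos : (k + 1 : ℝ) ≠ 0 := by positivity
  convert hS using 1 <;> push_cast <;> field_simp
  ring

end EqualDivision

section NearestPoint

variable {X : Type*} [PseudoMetricSpace X] [MeasurableSpace X] [OpensMeasurableSpace X]
  [Nonempty X]

/-- A point of `α` nearest to `x`; ties are broken so that the map is measurable in `x`. The value
on the empty set is arbitrary. -/
noncomputable def nearestPoint (α : Finset X) (x : X) : X :=
  SimpleFunc.nearestPt (fun k => α.toList.getD k (Classical.arbitrary X)) (α.card - 1) x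

lemma measurable_nearestPoint (α : Finset X) : Measurable (nearestPoint α) :=
  SimpleFunc.measurable _

lemma nearestPoint_mem {α : Finset X} (hα : α.Nonempty) (x : X) : nearestPoint α x ∈ α := by
  set e : ℕ → X := fun k => α.toList.getD k (Classical.arbitrary X)
  have hind := SimpleFunc.nearestPtInd_le e (α.card - 1) x
  have hlt : SimpleFunc.nearestPtInd e (α.card - 1) x < α.toList.length := by
    have hpos := hα.card_pos
    rw [Finset.length_toList]
    omega
  change e (SimpleFunc.nearestPtInd e (α.card - 1) x) ∈ α
  simp only [e, List.getD_eq_getElem _ _ hlt]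
  exact Finset.mem_toList.1 (List.getElem_mem hlt)

lemma dist_nearestPoint_le {α : Finset X} (x : X) {b : X} (hb : b ∈ α) :
    dist x (nearestPoint α x) ≤ dist x b := by
  obtain ⟨k, hk, rfl⟩ := List.mem_iff_getElem.1 (Finset.mem_toList.2 hb)
  have hle : k ≤ α.card - 1 := Nat.le_sub_one_of_lt (hk.trans_eq (Finset.length_toList α))
  have hnear := SimpleFunc.edist_nearestPt_le
    (fun k => α.toList.getD k (Classical.arbitrary X)) x hle
  rw [List.getD_eq_getElem _ _ hk] at hnear
  rw [dist_comm, dist_comm x, dist_edist, dist_edist]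
  exact ENNReal.toReal_mono (edist_ne_top _ _) hnear

lemma dist_nearestPoint_eq_infDist {α : Finset X} (hα : α.Nonempty) (x : X) :
    dist x (nearestPoint α x) = Metric.infDist x α :=
  le_antisymm ((Metric.le_infDist hα).2 fun _ hb => dist_nearestPoint_le x hb)
    (Metric.infDist_le_dist_of_mem (nearestPoint_mem hα x))

end NearestPoint

section Hexagon

/-- The unit vector along the `j`th side. -/
noncomputable def dir (j : Fin 6) : Plane := vertex (j + 1) - vertex j

lemma vertex_succ (j : Fin 6) : vertex (j + 1) = vertex j + dir j := by
  rw [dir, add_sub_cancel]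

lemma inner_dir_self (j : Fin 6) : inner ℝ (dir j) (dir j) = 1 := by
  have hsq : √3 * √3 = 3 := Real.mul_self_sqrt (by norm_num)
  have habs : |√3| = √3 := abs_of_nonneg (Real.sqrt_nonneg 3)
  rw [PiLp.inner_apply, Fin.sum_univ_two]
  fin_cases j <;> simp [dir, vertex, habs] <;> linarith

lemma inner_dir_succ (j : Fin 6) : inner ℝ (dir j) (dir (j + 1)) = 1 / 2 := by
  have hsq : √3 * √3 = 3 := Real.mul_self_sqrt (by norm_num)
  fin_cases j <;> simp [dir, vertex, PiLp.inner_apply, Fin.sum_univ_two] <;> linarith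

lemma inner_dir_add_two (j : Fin 6) : inner ℝ (dir j) (dir (j + 1 + 1)) = -1 / 2 := by
  have hsq : √3 * √3 = 3 := Real.mul_self_sqrt (by norm_num)
  fin_cases j <;> simp [dir, vertex, PiLp.inner_apply, Fin.sum_univ_two] <;> linarith

lemma norm_dir (j : Fin 6) : ‖dir j‖ = 1 := by
  rw [norm_eq_sqrt_real_inner, inner_dir_self, Real.sqrt_one]

/-- The arc length parametrization of the line through the `j`th side; the side itself corresponds
to the parameters in `[0, 1]`. -/
noncomputable def side (j : Fin 6) : ℝ →ᵃⁱ[ℝ] Plane where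
  toAffineMap := AffineMap.lineMap (vertex j) (vertex (j + 1))
  norm_map t := by
    rw [AffineMap.lineMap_linear, LinearMap.smulRight_apply, LinearMap.id_apply, vsub_eq_sub,
      norm_smul]
    exact (congrArg (‖t‖ * ·) (norm_dir j)).trans (mul_one _)

lemma coe_side (j : Fin 6) : ⇑(side j) = AffineMap.lineMap (vertex j) (vertex (j + 1)) := rfl

lemma side_eq_vertex_add (j : Fin 6) (t : ℝ) : side j t = vertex j + t • dir j := by
  rw [coe_side, AffineMap.lineMap_apply, vsub_eq_sub, vadd_eq_add, add_comm, dir]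

lemma side_mem_boundary (j : Fin 6) {t : ℝ} (ht : t ∈ Set.Icc (0 : ℝ) 1) :
    side j t ∈ boundary := by
  refine Set.mem_iUnion.2 ⟨j, ?_⟩
  rw [segment_eq_image_lineMap]
  exact ⟨t, ht, rfl⟩

/-- Oblique coordinates at the vertex `A_{i+1}` where the sides `i` and `i + 1` meet: `x` is
measured backwards along side `i` and `y` forwards along side `i + 1`. -/
noncomputable def cornerPt (i : Fin 6) (x y : ℝ) : Plane :=
  vertex (i + 1) - x • dir i + y • dir (i + 1)

lemma side_eq_cornerPt (i : Fin 6) (t : ℝ) : side i t = cornerPt i (1 - t) 0 := by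
  rw [side_eq_vertex_add, cornerPt, vertex_succ]; module

lemma side_succ_eq_cornerPt (i : Fin 6) (t : ℝ) : side (i + 1) t = cornerPt i 0 t := by
  rw [side_eq_vertex_add, cornerPt]; module

lemma vertex_eq_cornerPt (i : Fin 6) : vertex (i + 1) = cornerPt i 0 0 := by
  rw [cornerPt]; module

lemma norm_sq_smul_dir_sub_smul_dir (i : Fin 6) (x y : ℝ) :
    ‖y • dir (i + 1) - x • dir i‖ ^ 2 = x ^ 2 + y ^ 2 - x * y := by
  rw [norm_sub_sq_real, norm_smul, norm_smul, norm_dir, norm_dir, inner_smul_left, inner_smul_right,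
    real_inner_comm, inner_dir_succ, Real.norm_eq_abs, Real.norm_eq_abs, mul_one, mul_one, sq_abs,
    sq_abs, conj_trivial]
  ring

lemma dist_cornerPt_sq (i : Fin 6) (x y x' y' : ℝ) :
    dist (cornerPt i x y) (cornerPt i x' y') ^ 2
      = (x - x') ^ 2 + (y - y') ^ 2 - (x - x') * (y - y') := by
  have hsub : cornerPt i x y - cornerPt i x' y' = (y - y') • dir (i + 1) - (x - x') • dir i := by
    rw [cornerPt, cornerPt]; module
  rw [dist_eq_norm, hsub, norm_sq_smul_dir_sub_smul_dir]

lemma isOpenMap_cornerPt (i : Fin 6) :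
    IsOpenMap fun p : ℝ × ℝ => cornerPt i p.1 p.2 := by
  set L : ℝ × ℝ →ₗ[ℝ] Plane :=
    (LinearMap.toSpanSingleton ℝ Plane (-dir i)).coprod
      (LinearMap.toSpanSingleton ℝ Plane (dir (i + 1))) with hL
  have hLapply : ∀ p, L p = p.2 • dir (i + 1) - p.1 • dir i := fun p => by
    simp only [hL, LinearMap.coprod_apply, LinearMap.toSpanSingleton_apply]; module
  have hinj : Function.Injective L := by
    refine (injective_iff_map_eq_zero L).2 fun p hp => ?_
    have hzero := norm_sq_smul_dir_sub_smul_dir i p.1 p.2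
    rw [← hLapply, hp, norm_zero] at hzero
    have hx : p.1 = 0 := by nlinarith [sq_nonneg (p.1 - 2 * p.2), sq_nonneg p.1]
    have hy : p.2 = 0 := by nlinarith [sq_nonneg (p.2 - 2 * p.1), sq_nonneg p.2]
    exact Prod.ext hx hy
  have hsurj : Function.Surjective L :=
    (LinearMap.injective_iff_surjective_of_finrank_eq_finrank (by simp)).1 hinj
  have hcorner : (fun p : ℝ × ℝ => cornerPt i p.1 p.2) = (vertex (i + 1) + ·) ∘ L := by
    funext p
    rw [Function.comp_apply, hLapply, cornerPt]; module
  rw [hcorner]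
  exact (isOpenMap_add_left _).comp (L.isOpenMap_of_finiteDimensional hsurj)

lemma cornerPt_mem_region (i : Fin 6) {x y : ℝ} (hx : 0 ≤ x) (hy : 0 ≤ y) (hxy : x + y ≤ 1) :
    cornerPt i x y ∈ region := by
  have hvertex : ∀ j, vertex j ∈ region := fun j => subset_convexHull ℝ _ ⟨j, rfl⟩
  have hcombination := (convex_convexHull ℝ (Set.range vertex)).sum_mem (t := Finset.univ)
    (w := ![1 - x - y, x, y]) (z := ![vertex (i + 1), vertex i, vertex (i + 1 + 1)])
    (by intro k _; fin_cases k <;> simp <;> linarith)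
    (by simp only [Fin.sum_univ_three, Matrix.cons_val]; ring)
    (by intro k _; fin_cases k; exacts [hvertex (i + 1), hvertex i, hvertex (i + 1 + 1)])
  have hcorner : cornerPt i x y = (1 - x - y) • vertex (i + 1) + x • vertex i
      + y • vertex (i + 1 + 1) := by
    rw [vertex_succ (i + 1), cornerPt, vertex_succ i]; module
  rw [hcorner]
  simp only [Fin.sum_univ_three, Matrix.cons_val] at hcombination
  exact hcombination

lemma cornerPt_mem_interior_region (i : Fin 6) {x y : ℝ} (hx : 0 < x) (hy : 0 < y)
    (hxy : x + y < 1) : cornerPt i x y ∈ interior region := by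
  set T : Set (ℝ × ℝ) := {p | 0 < p.1 ∧ 0 < p.2 ∧ p.1 + p.2 < 1}
  have hT : IsOpen T :=
    (isOpen_lt continuous_const continuous_fst).inter
      ((isOpen_lt continuous_const continuous_snd).inter
        (isOpen_lt (continuous_fst.add continuous_snd) continuous_const))
  refine interior_maximal ?_ (isOpenMap_cornerPt i T hT) ⟨(x, y), ⟨hx, hy, hxy⟩, rfl⟩
  rintro _ ⟨p, ⟨hp₁, hp₂, hp⟩, rfl⟩
  exact cornerPt_mem_region i hp₁.le hp₂.le hp.le

/-- The sides `i` and `j` are distinct and have no common vertex. -/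
def FarSides (i j : Fin 6) : Prop := j ≠ i ∧ j ≠ i + 1 ∧ i ≠ j + 1

instance (i j : Fin 6) : Decidable (FarSides i j) := by unfold FarSides; infer_instance

lemma FarSides.eq_add {i j : Fin 6} (h : FarSides i j) :
    j = i + 1 + 1 ∨ j = i + 1 + 1 + 1 ∨ i = j + 1 + 1 := by
  revert i j; decide

lemma one_le_dist_of_inner_dir {k : Fin 6} {p q v : Plane} (hp : inner ℝ (dir k) (p - v) ≤ 0)
    (hq : 1 ≤ inner ℝ (dir k) (q - v)) : 1 ≤ dist p q := by
  have hcs := real_inner_le_norm (dir k) (q - p)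
  rw [norm_dir, one_mul, ← sub_sub_sub_cancel_right q p v, inner_sub_right,
    sub_sub_sub_cancel_right, ← dist_eq_norm, dist_comm] at hcs
  linarith

lemma inner_dir_succ_side_sub (i : Fin 6) (t : ℝ) :
    inner ℝ (dir (i + 1)) (side i t - vertex (i + 1)) = (t - 1) / 2 := by
  have hsub : side i t - vertex (i + 1) = (t - 1) • dir i := by
    rw [side_eq_vertex_add, vertex_succ]; module
  rw [hsub, inner_smul_right, real_inner_comm, inner_dir_succ]
  ring

lemma inner_dir_side_succ_sub (i : Fin 6) (t : ℝ) :
    inner ℝ (dir i) (side (i + 1) t - vertex i) = 1 + t / 2 := by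
  have hsub : side (i + 1) t - vertex i = dir i + t • dir (i + 1) := by
    rw [side_eq_vertex_add, vertex_succ]; module
  rw [hsub, inner_add_right, inner_smul_right, inner_dir_self, inner_dir_succ]
  ring

lemma inner_dir_side_add_two_sub (i : Fin 6) (t : ℝ) :
    inner ℝ (dir i) (side (i + 1 + 1) t - vertex i) = 1 + (1 - t) / 2 := by
  have hsub : side (i + 1 + 1) t - vertex i = dir i + dir (i + 1) + t • dir (i + 1 + 1) := by
    rw [side_eq_vertex_add, vertex_succ, vertex_succ]; module
  rw [hsub, inner_add_right, inner_add_right, inner_smul_right, inner_dir_self, inner_dir_succ,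
    inner_dir_add_two]
  ring

lemma FarSides.one_le_dist {i j : Fin 6} (h : FarSides i j) {s t : ℝ}
    (hs : s ∈ Set.Icc (0 : ℝ) 1) (ht : t ∈ Set.Icc (0 : ℝ) 1) :
    1 ≤ dist (side i s) (side j t) := by
  have hnear : ∀ (k : Fin 6) {u : ℝ}, u ≤ 1 →
      inner ℝ (dir (k + 1)) (side k u - vertex (k + 1)) ≤ 0 := fun k u hu => by
    rw [inner_dir_succ_side_sub]; linarith
  have htwo : ∀ (k : Fin 6) {u : ℝ}, 0 ≤ u →
      1 ≤ inner ℝ (dir k) (side (k + 1) u - vertex k) := fun k u hu => by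
    rw [inner_dir_side_succ_sub]; linarith
  rcases h.eq_add with rfl | rfl | rfl
  · exact one_le_dist_of_inner_dir (hnear i hs.2) (htwo (i + 1) ht.1)
  · refine one_le_dist_of_inner_dir (hnear i hs.2) ?_
    rw [inner_dir_side_add_two_sub]
    linarith [ht.2]
  · rw [dist_comm]
    exact one_le_dist_of_inner_dir (hnear j ht.2) (htwo (j + 1) hs.1)

end Hexagon

section Distortion

lemma integrableOn_dist_sq_side {j : Fin 6} {g : ℝ → Plane} (hg : Measurable g)
    {β : Finset Plane} (hgβ : ∀ t, g t ∈ β) :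
    IntegrableOn (fun t => dist (side j t) (g t) ^ 2) (Set.Icc 0 1) :=
  integrableOn_dist_sq (side j).continuous hg hgβ (Metric.isBounded_Icc _ _)

/-- The cost of sending the point `side j t` of the `j`th side to `g t`, for all `t ∈ [0, 1]`. -/
noncomputable def sideCost (j : Fin 6) (g : ℝ → Plane) : ℝ :=
  ∫ t in Set.Icc 0 1, dist (side j t) (g t) ^ 2

lemma sideCost_nonneg (j : Fin 6) (g : ℝ → Plane) : 0 ≤ sideCost j g :=
  integral_nonneg fun _ => sq_nonneg _

lemma lintegral_uniformDist {f : Plane → ENNReal} (hf : Measurable f) :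
    ∫⁻ x, f x ∂uniformDist = 6⁻¹ * ∑ j, ∫⁻ t in Set.Icc (0 : ℝ) 1, f (side j t) := by
  rw [uniformDist, lintegral_smul_measure, smul_eq_mul, lintegral_finsetSum_measure]
  exact congrArg _ (Finset.sum_congr rfl fun j _ =>
    lintegral_map hf (side j).continuous.measurable)

lemma distortion_uniformDist (α : Finset Plane) : distortion uniformDist α
    = 6⁻¹ * ∑ j, ∫⁻ t in Set.Icc (0 : ℝ) 1, ⨅ a ∈ α, edist (side j t) a ^ 2 :=
  lintegral_uniformDist (Measurable.biInf _ α.countable_toSet fun a _ => by fun_prop)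

lemma lintegral_edist_sq_side (j : Fin 6) {g : ℝ → Plane} (hg : Measurable g) {β : Finset Plane}
    (hgβ : ∀ t, g t ∈ β) :
    ∫⁻ t in Set.Icc 0 1, edist (side j t) (g t) ^ 2 = ENNReal.ofReal (sideCost j g) := by
  rw [sideCost, ofReal_integral_eq_lintegral_ofReal (integrableOn_dist_sq_side hg hgβ)
    (Eventually.of_forall fun _ => sq_nonneg _)]
  simp only [edist_dist, ENNReal.ofReal_pow dist_nonneg]

lemma distortion_uniformDist_le {β : Finset Plane} {g : Fin 6 → ℝ → Plane}
    (hg : ∀ j, Measurable (g j)) (hgβ : ∀ j t, g j t ∈ β) :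
    distortion uniformDist β ≤ 6⁻¹ * ENNReal.ofReal (∑ j, sideCost j (g j)) := by
  rw [distortion_uniformDist, ENNReal.ofReal_sum_of_nonneg fun j _ => sideCost_nonneg j _]
  gcongr with j
  rw [← lintegral_edist_sq_side j (hg j) (hgβ j)]
  exact lintegral_mono fun t => iInf₂_le (g j t) (hgβ j t)

lemma measurable_nearestPoint_side (α : Finset Plane) (j : Fin 6) :
    Measurable fun t => nearestPoint α (side j t) :=
  (measurable_nearestPoint α).comp (side j).continuous.measurable

lemma integrableOn_dist_sq_nearestPoint_side {α : Finset Plane} (hα : α.Nonempty) (j : Fin 6) :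
    IntegrableOn (fun t => dist (side j t) (nearestPoint α (side j t)) ^ 2) (Set.Icc 0 1) :=
  integrableOn_dist_sq_side (measurable_nearestPoint_side α j) fun _ => nearestPoint_mem hα _

lemma distortion_uniformDist_eq {α : Finset Plane} (hα : α.Nonempty) :
    distortion uniformDist α
      = 6⁻¹ * ENNReal.ofReal (∑ j, sideCost j fun t => nearestPoint α (side j t)) := by
  refine le_antisymm (distortion_uniformDist_le (measurable_nearestPoint_side α)
    fun _ _ => nearestPoint_mem hα _) ?_
  rw [distortion_uniformDist, ENNReal.ofReal_sum_of_nonneg fun j _ => sideCost_nonneg j _]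
  gcongr with j
  rw [← lintegral_edist_sq_side j (measurable_nearestPoint_side α j)
    fun _ => nearestPoint_mem hα _]
  refine lintegral_mono fun t => le_iInf₂ fun a ha => ?_
  rw [edist_dist, edist_dist]
  gcongr
  exact dist_nearestPoint_le _ ha

end Distortion

section OptimalMeans

variable {n : ℕ} {α : Finset Plane}

lemma IsOptimalMeans.nonempty (h : IsOptimalMeans uniformDist n α) (hn : n ≠ 0) :
    α.Nonempty := by
  by_contra hempty
  rw [Finset.not_nonempty_iff_eq_empty] at hempty
  have htop : distortion uniformDist α = ⊤ := by
    simp [hempty, distortion_uniformDist, ENNReal.mul_top]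
  have hle : quantizationError uniformDist n ≤ distortion uniformDist {0} :=
    iInf₂_le _ (by simpa using Nat.one_le_iff_ne_zero.2 hn)
  rw [← h.2, htop, distortion_uniformDist_eq (by simp)] at hle
  exact ENNReal.mul_ne_top (by simp) ENNReal.ofReal_ne_top (top_le_iff.1 hle)

lemma IsOptimalMeans.sum_sideCost_le (h : IsOptimalMeans uniformDist n α) (hα : α.Nonempty)
    {β : Finset Plane} (hcard : β.card ≤ n) {g : Fin 6 → ℝ → Plane}
    (hg : ∀ j, Measurable (g j)) (hgβ : ∀ j t, g j t ∈ β) :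
    ∑ j, sideCost j (fun t => nearestPoint α (side j t)) ≤ ∑ j, sideCost j (g j) := by
  have hle : distortion uniformDist α ≤ distortion uniformDist β := by
    rw [h.2]; exact iInf₂_le β hcard
  have hcost := hle.trans (distortion_uniformDist_le hg hgβ)
  rw [distortion_uniformDist_eq hα, ENNReal.mul_le_mul_iff_right (by simp) (by simp)] at hcost
  exact (ENNReal.ofReal_le_ofReal_iff
    (Finset.sum_nonneg fun j _ => sideCost_nonneg j (g j))).1 hcost

/-- The set of parameters on the `j`th side that are served by `a ∈ α`. -/
def cell (α : Finset Plane) (a : Plane) (j : Fin 6) : Set ℝ :=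
  {t ∈ Set.Icc 0 1 | nearestPoint α (side j t) = a}

/-- The length of the part of the `j`th side that is served by `a ∈ α`. -/
noncomputable def cellLength (α : Finset Plane) (a : Plane) (j : Fin 6) : ℝ :=
  volume.real (cell α a j)

/-- The mean parameter of the part of the `j`th side that is served by `a ∈ α`. If that part is a
null set, then this is the junk value `0`. -/
noncomputable def cellMean (α : Finset Plane) (a : Plane) (j : Fin 6) : ℝ :=
  ⨍ t in cell α a j, t

lemma cell_subset_Icc (α : Finset Plane) (a : Plane) (j : Fin 6) : cell α a j ⊆ Set.Icc 0 1 :=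
  fun _ ht => ht.1

lemma isBounded_cell (α : Finset Plane) (a : Plane) (j : Fin 6) :
    Bornology.IsBounded (cell α a j) :=
  (Metric.isBounded_Icc _ _).subset (cell_subset_Icc α a j)

lemma volume_cell_ne_top (α : Finset Plane) (a : Plane) (j : Fin 6) : volume (cell α a j) ≠ ⊤ :=
  (isBounded_cell α a j).measure_lt_top.ne

lemma measurableSet_nearestPoint_side_mem (α M : Finset Plane) (j : Fin 6) :
    MeasurableSet {t | nearestPoint α (side j t) ∈ M} :=
  measurable_nearestPoint_side α j M.measurableSet

lemma measurableSet_cell (α : Finset Plane) (a : Plane) (j : Fin 6) :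
    MeasurableSet (cell α a j) :=
  measurableSet_Icc.inter (measurable_nearestPoint_side α j (measurableSet_singleton a))

lemma cellLength_nonneg (α : Finset Plane) (a : Plane) (j : Fin 6) : 0 ≤ cellLength α a j :=
  measureReal_nonneg

lemma volume_cell_eq_zero {a : Plane} {j : Fin 6} (h : cellLength α a j = 0) :
    volume (cell α a j) = 0 :=
  (measureReal_eq_zero_iff (volume_cell_ne_top α a j)).1 h

lemma volume_cell_ne_zero {a : Plane} {j : Fin 6} (h : 0 < cellLength α a j) :
    volume (cell α a j) ≠ 0 :=
  fun h0 => h.ne' ((measureReal_eq_zero_iff (volume_cell_ne_top α a j)).2 h0)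

lemma cellMean_mem_Ioo {a : Plane} {j : Fin 6} (h : 0 < cellLength α a j) :
    cellMean α a j ∈ Set.Ioo 0 1 := by
  have hne := volume_cell_ne_zero h
  have hfin := volume_cell_ne_top α a j
  have hint := integrableOn_of_isBounded continuous_id (isBounded_cell α a j)
  constructor
  · by_contra! hle
    refine (measure_le_setAverage_pos hne hfin hint).ne'
      (measure_mono_null (t := {0}) ?_ (by simp))
    exact fun t ht => le_antisymm (ht.2.trans hle) ht.1.1.1
  · by_contra! hle
    refine (measure_setAverage_le_pos hne hfin hint).ne'
      (measure_mono_null (t := {1}) ?_ (by simp))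
    exact fun t ht => le_antisymm ht.1.1.2 (hle.trans ht.2)

lemma cellMean_mem_Icc {a : Plane} {j : Fin 6} (h : 0 < cellLength α a j) :
    cellMean α a j ∈ Set.Icc 0 1 :=
  Set.Ioo_subset_Icc_self (cellMean_mem_Ioo h)

lemma setIntegral_cell_dist_sq (α : Finset Plane) (a p : Plane) (j : Fin 6) :
    ∫ t in cell α a j, dist (side j t) p ^ 2
      = (∫ t in cell α a j, (t - cellMean α a j) ^ 2)
        + cellLength α a j * dist (side j (cellMean α a j)) p ^ 2 :=
  setIntegral_dist_sq_affineIsometry (side j) (isBounded_cell α a j) p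

lemma IsOptimalMeans.sum_setIntegral_le_of_replace (h : IsOptimalMeans uniformDist n α)
    (hα : α.Nonempty) {M S : Finset Plane} (hM : M ⊆ α) (hcard : S.card ≤ M.card)
    {I : Fin 6 → Set ℝ} (hI : ∀ j, MeasurableSet (I j)) (hI01 : ∀ j, I j ⊆ Set.Icc 0 1)
    (hserved : ∀ j, ∀ a ∈ M, volume (cell α a j \ I j) = 0) {g : Fin 6 → ℝ → Plane}
    (hg : ∀ j, Measurable (g j)) (hgS : ∀ j t, g j t ∈ S ∪ α \ M) :
    ∑ j, ∫ t in I j, dist (side j t) (nearestPoint α (side j t)) ^ 2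
      ≤ ∑ j, ∫ t in I j, dist (side j t) (g j t) ^ 2 := by
  classical
  set f : Fin 6 → ℝ → Plane := fun j t =>
    if t ∈ I j ∪ {t | nearestPoint α (side j t) ∈ M} then g j t else nearestPoint α (side j t)
  have hf : ∀ j, Measurable (f j) := fun j =>
    Measurable.ite ((hI j).union (measurableSet_nearestPoint_side_mem α M j)) (hg j)
      (measurable_nearestPoint_side α j)
  have hfS : ∀ j t, f j t ∈ S ∪ α \ M := fun j t => by
    by_cases ht : t ∈ I j ∪ {t | nearestPoint α (side j t) ∈ M}
    · simp only [f, if_pos ht, hgS j t]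
    · simp only [f, if_neg ht]
      exact Finset.mem_union_right _
        (Finset.mem_sdiff.2 ⟨nearestPoint_mem hα _, fun hmem => ht (Or.inr hmem)⟩)
  have hcard' : (S ∪ α \ M).card ≤ n := by
    have hunion := Finset.card_union_le S (α \ M)
    have hsdiff := Finset.card_sdiff_add_card_eq_card hM
    have hα' := h.1
    omega
  have hcost := h.sum_sideCost_le hα hcard' hf hfS
  rw [← sub_nonneg, ← Finset.sum_sub_distrib] at hcost ⊢
  refine hcost.trans_eq (Finset.sum_congr rfl fun j _ => ?_)
  have hon : ∫ t in I j, dist (side j t) (f j t) ^ 2 = ∫ t in I j, dist (side j t) (g j t) ^ 2 :=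
    setIntegral_congr_fun (hI j) fun t ht => by simp only [f, if_pos (Set.mem_union_left _ ht)]
  have hoff : ∫ t in Set.Icc 0 1 \ I j, dist (side j t) (f j t) ^ 2
      = ∫ t in Set.Icc 0 1 \ I j, dist (side j t) (nearestPoint α (side j t)) ^ 2 := by
    have hnull : ∀ᵐ t, ∀ a ∈ M, t ∉ cell α a j \ I j :=
      (Finset.eventually_all M).2 fun a ha => measure_eq_zero_iff_ae_notMem.1 (hserved j a ha)
    refine setIntegral_congr_ae (measurableSet_Icc.diff (hI j)) ?_
    filter_upwards [hnull] with t ht hmem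
    have hout : t ∉ I j ∪ {t | nearestPoint α (side j t) ∈ M} :=
      fun hin => hin.elim hmem.2 fun hM => ht _ hM ⟨⟨hmem.1, rfl⟩, hmem.2⟩
    simp only [f, if_neg hout]
  have hcutf := setIntegral_sdiff (hI j)
    (integrableOn_dist_sq_side (j := j) (hf j) (hfS j)) (hI01 j)
  have hcutα := setIntegral_sdiff (hI j) (integrableOn_dist_sq_nearestPoint_side hα j) (hI01 j)
  simp only [sideCost]
  linarith

lemma IsOptimalMeans.sum_cellLength_mul_le (h : IsOptimalMeans uniformDist n α) {b b' : Plane}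
    (hb : b ∈ α) {p : Fin 6 → Plane} (hp : ∀ j, p j ∈ insert b' (α.erase b)) :
    ∑ j, cellLength α b j * dist (side j (cellMean α b j)) b ^ 2
      ≤ ∑ j, cellLength α b j * dist (side j (cellMean α b j)) (p j) ^ 2 := by
  have hcost := h.sum_setIntegral_le_of_replace ⟨b, hb⟩ (M := {b}) (S := {b'})
    (Finset.singleton_subset_iff.2 hb) le_rfl (measurableSet_cell α b) (cell_subset_Icc α b)
    (fun j a ha => by simp [Finset.mem_singleton.1 ha]) (g := fun j _ => p j)
    (fun _ => measurable_const)
    (fun j _ => by rw [← Finset.erase_eq, ← Finset.insert_eq]; exact hp j)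
  have hserved : ∀ j, ∫ t in cell α b j, dist (side j t) (nearestPoint α (side j t)) ^ 2
      = ∫ t in cell α b j, dist (side j t) b ^ 2 := fun j =>
    setIntegral_congr_fun (measurableSet_cell α b j) fun t ht => by rw [ht.2]
  simp only [hserved, setIntegral_cell_dist_sq, Finset.sum_add_distrib] at hcost
  exact le_of_add_le_add_left hcost

lemma dist_side_cellMean_le {b d : Plane} (hd : d ∈ α) {j : Fin 6}
    (hj : 0 < cellLength α b j) :
    dist (side j (cellMean α b j)) b ≤ dist (side j (cellMean α b j)) d := by
  have hc := (side j).continuous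
  have hint : ∀ p, IntegrableOn (fun t => dist (side j t) p ^ 2) (cell α b j) := fun p =>
    integrableOn_of_isBounded (by fun_prop) (isBounded_cell α b j)
  have hle : ∫ t in cell α b j, dist (side j t) b ^ 2 ≤ ∫ t in cell α b j, dist (side j t) d ^ 2 :=
    setIntegral_mono_on (hint b) (hint d) (measurableSet_cell α b j) fun t ht =>
      pow_le_pow_left₀ dist_nonneg (ht.2 ▸ dist_nearestPoint_le (side j t) hd) 2
  rw [setIntegral_cell_dist_sq, setIntegral_cell_dist_sq] at hle
  exact le_of_sq_le_sq (le_of_mul_le_mul_left (le_of_add_le_add_left hle) hj) dist_nonneg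

lemma setIntegral_pos_of_isOpen {f : ℝ → ℝ} {s : Set ℝ} (hs : IsOpen s) (hne : s.Nonempty)
    (hint : IntegrableOn f s) (hf : ∀ t ∈ s, 0 < f t) : 0 < ∫ t in s, f t := by
  rw [setIntegral_pos_iff_support_of_nonneg_ae
    (ae_restrict_of_forall_mem hs.measurableSet fun t ht => (hf t ht).le) hint,
    Set.inter_eq_right.2 fun t ht => Function.mem_support.2 (hf t ht).ne']
  exact hs.measure_pos volume hne

/-- The decrease of the cost at the point `side j t` that comes from adding `x` to `α`. -/
noncomputable def costGain (α : Finset Plane) (x : Plane) (j : Fin 6) (t : ℝ) : ℝ :=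
  dist (side j t) (nearestPoint α (side j t)) ^ 2 - dist (side j t) x ^ 2

lemma continuous_costGain (hα : α.Nonempty) (x : Plane) (j : Fin 6) :
    Continuous (costGain α x j) := by
  have hc := (side j).continuous
  have hd : Continuous fun t => Metric.infDist (side j t) (α : Set Plane) :=
    (Metric.continuous_infDist_pt _).comp hc
  unfold costGain
  simp only [dist_nearestPoint_eq_infDist hα]
  fun_prop

lemma IsOptimalMeans.dist_nearestPoint_le_of_cellLength_eq_zero
    (h : IsOptimalMeans uniformDist n α) {a : Plane} (ha : a ∈ α)
    (hlen : ∀ j, cellLength α a j = 0) (x : Plane) (i : Fin 6) {s : ℝ} (hs : s ∈ Set.Ioo 0 1) :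
    dist (side i s) (nearestPoint α (side i s)) ≤ dist (side i s) x := by
  by_contra! hlt
  have hα : α.Nonempty := ⟨a, ha⟩
  set I : Fin 6 → Set ℝ := fun j => Set.Ioo 0 1 ∩ {t | 0 < costGain α x j t}
  have hopen : ∀ j, IsOpen (I j) := fun j =>
    isOpen_Ioo.inter (isOpen_lt continuous_const (continuous_costGain hα x j))
  have hI01 : ∀ j, I j ⊆ Set.Icc 0 1 := fun j =>
    Set.inter_subset_left.trans Set.Ioo_subset_Icc_self
  have hbounded : ∀ j, Bornology.IsBounded (I j) := fun j =>
    (Metric.isBounded_Icc 0 1).subset (hI01 j)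
  have hdist : ∀ j, Continuous fun t => dist (side j t) x ^ 2 := fun j => by
    have hc := (side j).continuous
    fun_prop
  have hcost := h.sum_setIntegral_le_of_replace hα (M := {a}) (S := {x})
    (Finset.singleton_subset_iff.2 ha) le_rfl (fun j => (hopen j).measurableSet) hI01
    (fun j b hb => measure_mono_null Set.sdiff_subset
      (volume_cell_eq_zero (Finset.mem_singleton.1 hb ▸ hlen j)))
    (g := fun _ _ => x) (fun _ => measurable_const) (fun _ _ => by simp)
  rw [← sub_nonpos, ← Finset.sum_sub_distrib] at hcost
  refine hcost.not_gt (Finset.sum_pos' (fun j _ => ?_) ⟨i, Finset.mem_univ i, ?_⟩)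
  all_goals rw [← integral_sub
    ((integrableOn_dist_sq_nearestPoint_side hα _).mono_set (hI01 _))
    (integrableOn_of_isBounded (hdist _) (hbounded _))]
  · exact setIntegral_nonneg (hopen j).measurableSet fun t ht => ht.2.le
  · exact setIntegral_pos_of_isOpen (hopen i)
      ⟨s, hs, sub_pos.2 (pow_lt_pow_left₀ hlt dist_nonneg two_ne_zero)⟩
      (integrableOn_of_isBounded (continuous_costGain hα x i) (hbounded i)) fun t ht => ht.2

lemma IsOptimalMeans.exists_cellLength_pos (h : IsOptimalMeans uniformDist n α) {a : Plane}
    (ha : a ∈ α) : ∃ j, 0 < cellLength α a j := by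
  by_contra! hlen
  obtain ⟨s, hs, hsα⟩ : ∃ s ∈ Set.Ioo (0 : ℝ) 1, side 0 s ∉ (α : Set Plane) := by
    by_contra! hsub
    exact (Set.Ioo_infinite one_pos).image (side 0).injective.injOn
      (α.finite_toSet.subset (Set.image_subset_iff.2 hsub))
  have hle := h.dist_nearestPoint_le_of_cellLength_eq_zero ha
    (fun j => (hlen j).antisymm (cellLength_nonneg α a j)) (side 0 s) 0 hs
  rw [dist_self] at hle
  exact hsα (dist_le_zero.1 hle ▸ nearestPoint_mem ⟨a, ha⟩ _)

lemma dist_le_dist_nearestPoint_add {x y : Plane} (hα : α.Nonempty) :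
    dist x (nearestPoint α x) ≤ dist x y + dist y (nearestPoint α y) := by
  rw [dist_nearestPoint_eq_infDist hα, dist_nearestPoint_eq_infDist hα, add_comm]
  exact Metric.infDist_le_infDist_add_dist

lemma exists_dist_side_nearestPoint_le {η : ℝ} (hη : 0 < η) : ∃ β : Finset Plane, β.Nonempty ∧
    ∀ j, ∀ t ∈ Set.Icc (0 : ℝ) 1, dist (side j t) (nearestPoint β (side j t)) ≤ η := by
  classical
  obtain ⟨T, hT, hcov⟩ := Metric.totallyBounded_iff.1
    (isCompact_Icc (a := (0 : ℝ)) (b := 1)).totallyBounded η hη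
  set β : Finset Plane := Finset.univ.biUnion fun j => hT.toFinset.image (side j)
  have hnet : ∀ j, ∀ t ∈ Set.Icc (0 : ℝ) 1, ∃ b ∈ β, dist (side j t) b ≤ η := by
    intro j t ht
    obtain ⟨u, hu, htu⟩ := Set.mem_iUnion₂.1 (hcov ht)
    refine ⟨side j u, Finset.mem_biUnion.2 ⟨j, Finset.mem_univ j,
      Finset.mem_image_of_mem _ (hT.mem_toFinset.2 hu)⟩, ?_⟩
    rw [(side j).dist_map]
    exact (Metric.mem_ball.1 htu).le
  refine ⟨β, (hnet 0 0 (by simp)).imp fun _ hb => hb.1, fun j t ht => ?_⟩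
  obtain ⟨b, hb, hbt⟩ := hnet j t ht
  exact (dist_nearestPoint_le _ hb).trans hbt

lemma sideCost_le_sq {j : Fin 6} {g : ℝ → Plane} {η : ℝ}
    (hg : ∀ t ∈ Set.Icc (0 : ℝ) 1, dist (side j t) (g t) ≤ η) : sideCost j g ≤ η ^ 2 := by
  have hnorm := norm_setIntegral_le_of_norm_le_const (C := η ^ 2) (μ := volume)
    (f := fun t => dist (side j t) (g t) ^ 2) (measure_Icc_lt_top (a := (0 : ℝ)) (b := 1))
    fun t ht => by
      rw [Real.norm_of_nonneg (sq_nonneg _)]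
      exact pow_le_pow_left₀ dist_nonneg (hg t ht) 2
  rw [Real.volume_real_Icc_of_le zero_le_one, sub_zero, mul_one] at hnorm
  exact (Real.le_norm_self _).trans hnorm

lemma half_pow_three_le_sideCost (hα : α.Nonempty) {j : Fin 6} {s δ : ℝ} (hs : s ∈ Set.Icc 0 1)
    (hδ0 : 0 ≤ δ) (hδ1 : δ ≤ 1) (hfar : δ ≤ dist (side j s) (nearestPoint α (side j s))) :
    (δ / 2) ^ 3 ≤ sideCost j fun t => nearestPoint α (side j t) := by
  obtain ⟨u, hu, hus, hsu⟩ : ∃ u, Set.Icc u (u + δ / 2) ⊆ Set.Icc (0 : ℝ) 1 ∧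
      s ≤ u + δ / 2 ∧ u ≤ s := by
    rcases le_total s (1 / 2) with h | h
    · exact ⟨s, Set.Icc_subset_Icc hs.1 (by linarith), by linarith, le_rfl⟩
    · exact ⟨s - δ / 2, Set.Icc_subset_Icc (by linarith) (by linarith [hs.2]),
        by linarith, by linarith⟩
  have hnear : ∀ t ∈ Set.Icc u (u + δ / 2),
      (δ / 2) ^ 2 ≤ dist (side j t) (nearestPoint α (side j t)) ^ 2 := by
    intro t ht
    have hadd := dist_le_dist_nearestPoint_add hα (x := side j s) (y := side j t)
    have hst : dist (side j s) (side j t) ≤ δ / 2 := by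
      rw [(side j).dist_map, Real.dist_eq, abs_le]
      constructor <;> linarith [ht.1, ht.2]
    exact pow_le_pow_left₀ (by linarith) (by linarith) 2
  have hint := integrableOn_dist_sq_nearestPoint_side hα j
  calc (δ / 2) ^ 3 = ∫ _ in Set.Icc u (u + δ / 2), (δ / 2) ^ 2 := by
        rw [setIntegral_const, Real.volume_real_Icc_of_le (by linarith), smul_eq_mul]; ring
    _ ≤ ∫ t in Set.Icc u (u + δ / 2), dist (side j t) (nearestPoint α (side j t)) ^ 2 :=
        setIntegral_mono_on (integrableOn_const (by simp)) (hint.mono_set hu) measurableSet_Icc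
          hnear
    _ ≤ sideCost j fun t => nearestPoint α (side j t) :=
        setIntegral_mono_set hint (Eventually.of_forall fun _ => sq_nonneg _)
          (Eventually.of_forall hu)

lemma exists_forall_dist_side_nearestPoint_lt {δ : ℝ} (hδ0 : 0 < δ) (hδ1 : δ ≤ 1) :
    ∃ N : ℕ, 1 ≤ N ∧ ∀ n, N ≤ n → ∀ α, IsOptimalMeans uniformDist n α → ∀ j,
      ∀ s ∈ Set.Icc (0 : ℝ) 1, dist (side j s) (nearestPoint α (side j s)) < δ := by
  obtain ⟨β, hβ, hβnear⟩ := exists_dist_side_nearestPoint_le (η := δ ^ 2 / 8) (by positivity)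
  refine ⟨β.card, hβ.card_pos, fun n hn α h j s hs => ?_⟩
  have hα := h.nonempty (hβ.card_pos.trans_le hn).ne'
  by_contra! hfar
  have hcost := h.sum_sideCost_le hα hn (measurable_nearestPoint_side β)
    fun _ _ => nearestPoint_mem hβ _
  have hβcost := Finset.sum_le_sum fun i (_ : i ∈ Finset.univ) => sideCost_le_sq (hβnear i)
  have hαcost := (half_pow_three_le_sideCost hα hs hδ0.le hδ1 hfar).trans
    (Finset.single_le_sum (f := fun i => sideCost i fun t => nearestPoint α (side i t))
      (fun i _ => sideCost_nonneg i _) (Finset.mem_univ j))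
  rw [Finset.sum_const, Finset.card_univ, Fintype.card_fin, nsmul_eq_mul] at hβcost
  have hchain : (δ / 2) ^ 3 ≤ 6 * (δ ^ 2 / 8) ^ 2 := by
    exact_mod_cast hαcost.trans (hcost.trans hβcost)
  have hδ4 : δ ^ 3 * δ ≤ δ ^ 3 * 1 := by gcongr
  linarith [hchain, pow_pos hδ0 3]

end OptimalMeans

/-- An optimal set of `n`-means that comes within `δ` of every point of the boundary. -/
structure IsFineOptimal (n : ℕ) (δ : ℝ) (α : Finset Plane) : Prop where
  isOptimalMeans : IsOptimalMeans uniformDist n α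
  nonempty : α.Nonempty
  dist_lt : ∀ p ∈ boundary, dist p (nearestPoint α p) < δ

/-- The point `a` serves a part of positive length of the `j`th side, and of no other side. -/
structure ServesOnly (α : Finset Plane) (a : Plane) (j : Fin 6) : Prop where
  pos : 0 < cellLength α a j
  eq_zero : ∀ k, k ≠ j → cellLength α a k = 0

/-- The point `a` serves parts of positive length of the two sides `i` and `i + 1` that meet at
`vertex (i + 1)`, and of no other side. -/
structure ServesCorner (α : Finset Plane) (a : Plane) (i : Fin 6) : Prop where
  pos_left : 0 < cellLength α a i
  pos_right : 0 < cellLength α a (i + 1)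
  eq_zero : ∀ k, k ≠ i → k ≠ i + 1 → cellLength α a k = 0

variable {n : ℕ} {δ : ℝ} {α : Finset Plane}

lemma exists_isFineOptimal (hδ0 : 0 < δ) (hδ1 : δ ≤ 1) :
    ∃ N : ℕ, ∀ n, N ≤ n → ∀ α, IsOptimalMeans uniformDist n α → IsFineOptimal n δ α := by
  obtain ⟨N, hN, hdist⟩ := exists_forall_dist_side_nearestPoint_lt hδ0 hδ1
  refine ⟨N, fun n hn α h => ⟨h, h.nonempty (by omega), fun p hp => ?_⟩⟩
  obtain ⟨j, hj⟩ := Set.mem_iUnion.1 hp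
  rw [segment_eq_image_lineMap] at hj
  obtain ⟨t, ht, rfl⟩ := hj
  exact hdist n hn α h j t ht

lemma IsFineOptimal.dist_side_cellMean_lt (h : IsFineOptimal n δ α) {a : Plane} {j : Fin 6}
    (hj : 0 < cellLength α a j) : dist (side j (cellMean α a j)) a < δ :=
  (dist_side_cellMean_le (nearestPoint_mem h.nonempty _) hj).trans_lt
    (h.dist_lt _ (side_mem_boundary j (Set.Ioo_subset_Icc_self (cellMean_mem_Ioo hj))))

lemma IsFineOptimal.cellLength_le (h : IsFineOptimal n δ α) (hδ : 0 ≤ δ) (a : Plane) (j : Fin 6) :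
    cellLength α a j ≤ 2 * δ := by
  obtain ⟨c, hc⟩ := exists_abs_sub_le_dist_affineIsometry (side j) a
  have hsub : cell α a j ⊆ Set.Icc (c - δ) (c + δ) := fun t ht => by
    have hdist := h.dist_lt _ (side_mem_boundary j ht.1)
    rw [ht.2] at hdist
    have habs := abs_le.1 ((hc t).trans hdist.le)
    constructor <;> linarith
  calc cellLength α a j ≤ volume.real (Set.Icc (c - δ) (c + δ)) := measureReal_mono hsub (by simp)
    _ = 2 * δ := by rw [Real.volume_real_Icc_of_le (by linarith)]; ring

section ServedSides

lemma IsFineOptimal.not_farSides (h : IsFineOptimal n δ α) (hδ : δ ≤ 1 / 24) {a : Plane}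
    {i j : Fin 6} (hi : 0 < cellLength α a i) (hj : 0 < cellLength α a j) : ¬FarSides i j := by
  intro hfar
  have hone := hfar.one_le_dist (Set.Ioo_subset_Icc_self (cellMean_mem_Ioo hi))
    (Set.Ioo_subset_Icc_self (cellMean_mem_Ioo hj))
  have htriangle := dist_triangle_right (side i (cellMean α a i)) (side j (cellMean α a j)) a
  linarith [h.dist_side_cellMean_lt hi, h.dist_side_cellMean_lt hj]

lemma eq_singleton_or_pair_of_not_farSides : ∀ C : Finset (Fin 6), C.Nonempty →
    (∀ i ∈ C, ∀ j ∈ C, ¬FarSides i j) → (∃ j, C = {j}) ∨ ∃ i, C = {i, i + 1} := by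
  decide

lemma IsFineOptimal.servesOnly_or_servesCorner (h : IsFineOptimal n δ α) (hδ : δ ≤ 1 / 24)
    {a : Plane} (ha : a ∈ α) : (∃ j, ServesOnly α a j) ∨ ∃ i, ServesCorner α a i := by
  classical
  set C : Finset (Fin 6) := Finset.univ.filter fun k => 0 < cellLength α a k with hC
  have hmem : ∀ {k}, k ∈ C ↔ 0 < cellLength α a k := by simp [hC]
  have hnotMem : ∀ {k}, k ∉ C → cellLength α a k = 0 := fun hk =>
    (not_lt.1 fun hlt => hk (hmem.2 hlt)).antisymm (cellLength_nonneg α a _)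
  rcases eq_singleton_or_pair_of_not_farSides C
    ((h.isOptimalMeans.exists_cellLength_pos ha).imp fun _ => hmem.2)
    fun i hi j hj => h.not_farSides hδ (hmem.1 hi) (hmem.1 hj) with ⟨j, hj⟩ | ⟨i, hi⟩
  · exact Or.inl ⟨j, hmem.1 (by simp [hj]), fun k hk => hnotMem (by simp [hj, hk])⟩
  · exact Or.inr ⟨i, hmem.1 (by simp [hi]), hmem.1 (by simp [hi]),
      fun k hk hk' => hnotMem (by simp [hi, hk, hk'])⟩

lemma ServesOnly.sum_cellLength_mul {a : Plane} {j : Fin 6} (ha : ServesOnly α a j)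
    (f : Fin 6 → ℝ) : ∑ k, cellLength α a k * f k = cellLength α a j * f j :=
  Finset.sum_eq_single j (fun k _ hk => by rw [ha.eq_zero k hk, zero_mul]) (by simp)

lemma ServesCorner.sum_cellLength_mul {a : Plane} {i : Fin 6} (ha : ServesCorner α a i)
    (f : Fin 6 → ℝ) : ∑ k, cellLength α a k * f k
      = cellLength α a i * f i + cellLength α a (i + 1) * f (i + 1) :=
  Finset.sum_eq_add i (i + 1) (by simp)
    (fun k _ hk => by rw [ha.eq_zero k hk.1 hk.2, zero_mul]) (by simp) (by simp)

lemma ServesOnly.eq_side_cellMean (h : IsOptimalMeans uniformDist n α) {a : Plane} (ha : a ∈ α)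
    {j : Fin 6} (hj : ServesOnly α a j) : a = side j (cellMean α a j) := by
  have hle := h.sum_cellLength_mul_le ha (b' := side j (cellMean α a j))
    (p := fun _ => side j (cellMean α a j)) fun _ => Finset.mem_insert_self _ _
  rw [hj.sum_cellLength_mul, hj.sum_cellLength_mul, dist_self, zero_pow two_ne_zero, mul_zero]
    at hle
  have hsq := nonpos_of_mul_nonpos_right hle hj.pos
  exact (dist_eq_zero.1 (sq_eq_zero_iff.1 (hsq.antisymm (sq_nonneg _)))).symm

end ServedSides

section ServesCorner

variable {a b d : Plane} {i : Fin 6}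

/-- The distance from `vertex (i + 1)` to the mean of the part of side `i` that is served by
`a`. -/
noncomputable def leftArm (α : Finset Plane) (a : Plane) (i : Fin 6) : ℝ :=
  1 - cellMean α a i

/-- The distance from `vertex (i + 1)` to the mean of the part of side `i + 1` that is served by
`a`. -/
noncomputable def rightArm (α : Finset Plane) (a : Plane) (i : Fin 6) : ℝ :=
  cellMean α a (i + 1)

lemma side_cellMean (i : Fin 6) : side i (cellMean α a i) = cornerPt i (leftArm α a i) 0 :=
  side_eq_cornerPt i _

lemma side_succ_cellMean (i : Fin 6) :
    side (i + 1) (cellMean α a (i + 1)) = cornerPt i 0 (rightArm α a i) :=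
  side_succ_eq_cornerPt i _

lemma ServesCorner.leftArm_pos (hb : ServesCorner α b i) : 0 < leftArm α b i :=
  sub_pos.2 (cellMean_mem_Ioo hb.pos_left).2

lemma ServesCorner.rightArm_pos (hb : ServesCorner α b i) : 0 < rightArm α b i :=
  (cellMean_mem_Ioo hb.pos_right).1

lemma ServesCorner.dist_leftArm_le (hb : ServesCorner α b i) (hd : d ∈ α) :
    dist (cornerPt i (leftArm α b i) 0) b ≤ dist (cornerPt i (leftArm α b i) 0) d := by
  rw [← side_cellMean]
  exact dist_side_cellMean_le hd hb.pos_left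

lemma ServesCorner.dist_rightArm_le (hb : ServesCorner α b i) (hd : d ∈ α) :
    dist (cornerPt i 0 (rightArm α b i)) b ≤ dist (cornerPt i 0 (rightArm α b i)) d := by
  rw [← side_succ_cellMean]
  exact dist_side_cellMean_le hd hb.pos_right

lemma ServesCorner.cost_le (h : IsOptimalMeans uniformDist n α) (hbα : b ∈ α)
    (hb : ServesCorner α b i) {b' p q : Plane} (hp : p ∈ insert b' (α.erase b))
    (hq : q ∈ insert b' (α.erase b)) :
    cellLength α b i * dist (cornerPt i (leftArm α b i) 0) b ^ 2
        + cellLength α b (i + 1) * dist (cornerPt i 0 (rightArm α b i)) b ^ 2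
      ≤ cellLength α b i * dist (cornerPt i (leftArm α b i) 0) p ^ 2
        + cellLength α b (i + 1) * dist (cornerPt i 0 (rightArm α b i)) q ^ 2 := by
  have hle := h.sum_cellLength_mul_le hbα (b' := b') (p := fun j => if j = i then p else q)
    fun j => by split_ifs <;> assumption
  rw [hb.sum_cellLength_mul, hb.sum_cellLength_mul, if_pos rfl, if_neg (by simp), side_cellMean,
    side_succ_cellMean] at hle
  exact hle

lemma ServesCorner.eq_lineMap (h : IsOptimalMeans uniformDist n α) (hbα : b ∈ α)
    (hb : ServesCorner α b i) :
    b = AffineMap.lineMap (cornerPt i (leftArm α b i) 0) (cornerPt i 0 (rightArm α b i))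
      (cellLength α b (i + 1) / (cellLength α b i + cellLength α b (i + 1))) := by
  have hw : 0 < cellLength α b i + cellLength α b (i + 1) := add_pos hb.pos_left hb.pos_right
  set c := AffineMap.lineMap (cornerPt i (leftArm α b i) 0) (cornerPt i 0 (rightArm α b i))
    (cellLength α b (i + 1) / (cellLength α b i + cellLength α b (i + 1)))
  have hle := hb.cost_le h hbα (b' := c) (Finset.mem_insert_self _ _) (Finset.mem_insert_self _ _)
  rw [← add_mul_dist_sq_lineMap _ _ _ hw.ne', ← add_mul_dist_sq_lineMap _ _ _ hw.ne',
    add_le_add_iff_right, dist_self, zero_pow two_ne_zero, mul_zero] at hle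
  have hsq := nonpos_of_mul_nonpos_right hle hw
  exact (dist_eq_zero.1 (sq_eq_zero_iff.1 (hsq.antisymm (sq_nonneg _)))).symm

lemma ServesCorner.mem_segment (h : IsOptimalMeans uniformDist n α) (hbα : b ∈ α)
    (hb : ServesCorner α b i) :
    b ∈ segment ℝ (cornerPt i (leftArm α b i) 0) (cornerPt i 0 (rightArm α b i)) := by
  have hw₁ := hb.pos_left
  have hw₂ := hb.pos_right
  rw [segment_eq_image_lineMap]
  exact ⟨_, ⟨by positivity, (div_le_one (by positivity)).2 (by linarith)⟩,
    (hb.eq_lineMap h hbα).symm⟩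

lemma lineMap_cornerPt (i : Fin 6) (x y x' y' θ : ℝ) :
    AffineMap.lineMap (cornerPt i x y) (cornerPt i x' y') θ
      = cornerPt i ((1 - θ) * x + θ * x') ((1 - θ) * y + θ * y') := by
  rw [AffineMap.lineMap_apply_module, cornerPt, cornerPt, cornerPt]
  module

lemma ServesCorner.exists_eq_cornerPt (h : IsOptimalMeans uniformDist n α) (hbα : b ∈ α)
    (hb : ServesCorner α b i) : ∃ x ∈ Set.Ioo 0 (leftArm α b i), ∃ y ∈ Set.Ioo 0 (rightArm α b i),
      b = cornerPt i x y := by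
  have hw₁ := hb.pos_left
  have hw₂ := hb.pos_right
  have hq₁ := hb.leftArm_pos
  have hq₂ := hb.rightArm_pos
  have heq := hb.eq_lineMap h hbα
  set θ := cellLength α b (i + 1) / (cellLength α b i + cellLength α b (i + 1))
  have hθ0 : 0 < θ := by positivity
  have hθ1 : θ < 1 := (div_lt_one (by positivity)).2 (by linarith)
  rw [lineMap_cornerPt, mul_zero, mul_zero, add_zero, zero_add] at heq
  exact ⟨_, ⟨mul_pos (sub_pos.2 hθ1) hq₁, mul_lt_of_lt_one_left hq₁ (by linarith)⟩, _,
    ⟨mul_pos hθ0 hq₂, mul_lt_of_lt_one_left hq₂ hθ1⟩, heq⟩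

lemma ServesCorner.le_mul_dist_sq_left (h : IsOptimalMeans uniformDist n α) (hbα : b ∈ α)
    (hb : ServesCorner α b i) (hd : d ∈ α) (hdb : d ≠ b) :
    cellLength α b (i + 1) * dist (cornerPt i (leftArm α b i) 0) (cornerPt i 0 (rightArm α b i)) ^ 2
      ≤ (cellLength α b i + cellLength α b (i + 1))
        * dist (cornerPt i (leftArm α b i) 0) d ^ 2 := by
  have hw₁ := hb.pos_left
  have hw : 0 < cellLength α b i + cellLength α b (i + 1) := add_pos hb.pos_left hb.pos_right
  have hle := hb.cost_le h hbα (Finset.mem_insert_of_mem (Finset.mem_erase.2 ⟨hdb, hd⟩))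
    (Finset.mem_insert_self (cornerPt i 0 (rightArm α b i)) _)
  rw [← add_mul_dist_sq_lineMap _ _ _ hw.ne', dist_self, zero_pow two_ne_zero, mul_zero,
    add_zero] at hle
  have hdrop := (le_add_of_nonneg_left (mul_nonneg hw.le (sq_nonneg _))).trans hle
  rw [div_mul_eq_mul_div, div_le_iff₀ hw] at hdrop
  exact le_of_mul_le_mul_left (by linarith) hw₁

lemma ServesCorner.le_mul_dist_sq_right (h : IsOptimalMeans uniformDist n α) (hbα : b ∈ α)
    (hb : ServesCorner α b i) (hd : d ∈ α) (hdb : d ≠ b) :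
    cellLength α b i * dist (cornerPt i (leftArm α b i) 0) (cornerPt i 0 (rightArm α b i)) ^ 2
      ≤ (cellLength α b i + cellLength α b (i + 1))
        * dist (cornerPt i 0 (rightArm α b i)) d ^ 2 := by
  have hw₂ := hb.pos_right
  have hw : 0 < cellLength α b i + cellLength α b (i + 1) := add_pos hb.pos_left hb.pos_right
  have hle := hb.cost_le h hbα (Finset.mem_insert_self (cornerPt i (leftArm α b i) 0) _)
    (Finset.mem_insert_of_mem (Finset.mem_erase.2 ⟨hdb, hd⟩))
  rw [← add_mul_dist_sq_lineMap _ _ _ hw.ne', dist_self, zero_pow two_ne_zero, mul_zero,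
    zero_add] at hle
  have hdrop := (le_add_of_nonneg_left (mul_nonneg hw.le (sq_nonneg _))).trans hle
  rw [div_mul_eq_mul_div, div_le_iff₀ hw] at hdrop
  exact le_of_mul_le_mul_left (by linarith) hw₂

/- In the parallelogram `P₁ V P₂ W` that is spanned by the two arms at the vertex `V`, the angles
at `V` and `W` are `2π/3`, so that the segment `P₁ P₂` is seen from every other point of the
parallelogram at an obtuse angle. -/
lemma dist_sq_add_dist_sq_cornerPt_lt {q₁ q₂ x y : ℝ} (hq₁ : 0 < q₁) (hq₂ : 0 < q₂)
    (hx : x ∈ Set.Icc 0 q₁) (hy : y ∈ Set.Icc 0 q₂)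
    (hne₁ : cornerPt i x y ≠ cornerPt i q₁ 0) (hne₂ : cornerPt i x y ≠ cornerPt i 0 q₂) :
    dist (cornerPt i q₁ 0) (cornerPt i x y) ^ 2 + dist (cornerPt i 0 q₂) (cornerPt i x y) ^ 2
      < dist (cornerPt i q₁ 0) (cornerPt i 0 q₂) ^ 2 := by
  rw [dist_cornerPt_sq, dist_cornerPt_sq, dist_cornerPt_sq]
  have hfar := mul_nonneg (sub_nonneg.2 hx.2) (sub_nonneg.2 hy.2)
  have hnear := mul_nonneg hx.1 hy.1
  have hleft := mul_nonneg hx.1 (sub_nonneg.2 hx.2)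
  have hright := mul_nonneg hy.1 (sub_nonneg.2 hy.2)
  by_contra! hle
  have hfar0 : (q₁ - x) * (q₂ - y) = 0 := by linarith
  have hnear0 : x * y = 0 := by linarith
  rcases mul_eq_zero.1 hfar0 with hx' | hy'
  · obtain rfl : q₁ = x := sub_eq_zero.1 hx'
    exact hne₁ (by rw [(mul_eq_zero.1 hnear0).resolve_left hq₁.ne'])
  · obtain rfl : q₂ = y := sub_eq_zero.1 hy'
    exact hne₂ (by rw [(mul_eq_zero.1 hnear0).resolve_right hq₂.ne'])

lemma cornerPt_zero_right_ne_zero_left {q₁ q₂ : ℝ} (hq₁ : 0 < q₁) :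
    cornerPt i q₁ 0 ≠ cornerPt i 0 q₂ := by
  intro heq
  have hsq := dist_cornerPt_sq i q₁ 0 0 q₂
  rw [heq, dist_self] at hsq
  nlinarith [sq_nonneg (2 * q₂ + q₁), pow_pos hq₁ 2]

lemma ServesCorner.cornerPt_notMem (h : IsOptimalMeans uniformDist n α) (hbα : b ∈ α)
    (hb : ServesCorner α b i) {x y : ℝ} (hx : x ∈ Set.Icc 0 (leftArm α b i))
    (hy : y ∈ Set.Icc 0 (rightArm α b i)) (hxy : cornerPt i x y ≠ b) : cornerPt i x y ∉ α := by
  intro hd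
  have hw₁ := hb.pos_left
  have hw₂ := hb.pos_right
  have hPP := dist_pos.2 (cornerPt_zero_right_ne_zero_left (i := i) (q₂ := rightArm α b i)
    hb.leftArm_pos)
  have hleft := hb.le_mul_dist_sq_left h hbα hd hxy
  have hright := hb.le_mul_dist_sq_right h hbα hd hxy
  have hne₁ : cornerPt i x y ≠ cornerPt i (leftArm α b i) 0 := fun heq => by
    rw [heq, dist_self, zero_pow two_ne_zero, mul_zero] at hleft
    exact hleft.not_gt (by positivity)
  have hne₂ : cornerPt i x y ≠ cornerPt i 0 (rightArm α b i) := fun heq => by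
    rw [heq, dist_self, zero_pow two_ne_zero, mul_zero] at hright
    exact hright.not_gt (by positivity)
  have hobtuse := mul_lt_mul_of_pos_left
    (dist_sq_add_dist_sq_cornerPt_lt hb.leftArm_pos hb.rightArm_pos hx hy hne₁ hne₂)
    (add_pos hw₁ hw₂)
  linarith

lemma cornerPt_zero_right_mem_segment {x q : ℝ} (hx : 0 ≤ x) (hxq : x ≤ q) (hq : 0 < q) :
    cornerPt i x 0 ∈ segment ℝ (vertex (i + 1)) (cornerPt i q 0) := by
  rw [vertex_eq_cornerPt, segment_eq_image_lineMap]
  refine ⟨x / q, ⟨by positivity, (div_le_one hq).2 hxq⟩, ?_⟩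
  rw [lineMap_cornerPt, div_mul_cancel₀ _ hq.ne', mul_zero, mul_zero, zero_add, zero_add]

lemma cornerPt_zero_left_mem_segment {y q : ℝ} (hy : 0 ≤ y) (hyq : y ≤ q) (hq : 0 < q) :
    cornerPt i 0 y ∈ segment ℝ (vertex (i + 1)) (cornerPt i 0 q) := by
  rw [vertex_eq_cornerPt, segment_eq_image_lineMap]
  refine ⟨y / q, ⟨by positivity, (div_le_one hq).2 hyq⟩, ?_⟩
  rw [lineMap_cornerPt, div_mul_cancel₀ _ hq.ne', mul_zero, mul_zero, zero_add, zero_add]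

lemma cornerPt_zero_right_ne {x x' : ℝ} (h : x ≠ x') : cornerPt i x 0 ≠ cornerPt i x' 0 := by
  intro heq
  have hsq := dist_cornerPt_sq i x 0 x' 0
  rw [heq, dist_self, sub_self, mul_zero, sub_zero, zero_pow two_ne_zero, add_zero] at hsq
  exact h (sub_eq_zero.1 (sq_eq_zero_iff.1 hsq.symm))

lemma cornerPt_zero_left_ne {y y' : ℝ} (h : y ≠ y') : cornerPt i 0 y ≠ cornerPt i 0 y' := by
  intro heq
  have hsq := dist_cornerPt_sq i 0 y 0 y'
  rw [heq, dist_self, sub_self, zero_mul, sub_zero, zero_pow two_ne_zero, zero_add] at hsq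
  exact h (sub_eq_zero.1 (sq_eq_zero_iff.1 hsq.symm))

lemma ServesCorner.eq_of_leftArm_lt (h : IsOptimalMeans uniformDist n α) (hbα : b ∈ α)
    (hdα : d ∈ α) (hb : ServesCorner α b i) (hd : ServesCorner α d i)
    (hlt₁ : leftArm α d i < leftArm α b i) (hlt₂ : rightArm α b i < rightArm α d i) : b = d := by
  have hR₁ := cornerPt_zero_right_mem_segment (i := i) hd.leftArm_pos.le hlt₁.le hb.leftArm_pos
  have hQ₂ := cornerPt_zero_left_mem_segment (i := i) hb.rightArm_pos.le hlt₂.le hd.rightArm_pos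
  rw [segment_symm] at hQ₂
  have hvertex : dist (vertex (i + 1)) b ≤ dist (vertex (i + 1)) d := by
    by_contra! hlt
    rw [segment_symm] at hQ₂
    exact (dist_lt_of_mem_segment hlt (hd.dist_rightArm_le hbα) hQ₂
      (cornerPt_zero_left_ne hlt₂.ne)).not_ge (hb.dist_rightArm_le hdα)
  have hvertex' : dist (vertex (i + 1)) d ≤ dist (vertex (i + 1)) b := by
    by_contra! hlt
    exact (dist_lt_of_mem_segment hlt (hb.dist_leftArm_le hdα) hR₁
      (cornerPt_zero_right_ne hlt₁.ne)).not_ge (hd.dist_leftArm_le hbα)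
  have hright : dist (cornerPt i 0 (rightArm α d i)) b
      ≤ dist (cornerPt i 0 (rightArm α d i)) d := by
    by_contra! hlt
    refine (dist_lt_of_mem_segment hlt hvertex' hQ₂ ?_).not_ge (hb.dist_rightArm_le hdα)
    rw [vertex_eq_cornerPt]
    exact cornerPt_zero_left_ne hb.rightArm_pos.ne'
  have hself := dist_le_of_mem_segment
    (dist_le_of_mem_segment hvertex (hb.dist_leftArm_le hdα) hR₁) hright (hd.mem_segment h hdα)
  rw [dist_self] at hself
  exact (dist_le_zero.1 hself).symm

lemma ServesCorner.unique (h : IsOptimalMeans uniformDist n α) (hbα : b ∈ α) (hdα : d ∈ α)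
    (hb : ServesCorner α b i) (hd : ServesCorner α d i) : b = d := by
  by_contra hne
  wlog hle : leftArm α d i ≤ leftArm α b i generalizing b d
  · exact this hdα hbα hd hb (Ne.symm hne) (not_le.1 hle).le
  obtain ⟨x, hx, y, hy, hbxy⟩ := hb.exists_eq_cornerPt h hbα
  obtain ⟨x', hx', y', hy', hdxy⟩ := hd.exists_eq_cornerPt h hdα
  rcases le_or_gt (rightArm α d i) (rightArm α b i) with hle₂ | hlt₂
  · exact hb.cornerPt_notMem h hbα ⟨hx'.1.le, by linarith [hx'.2]⟩ ⟨hy'.1.le, by linarith [hy'.2]⟩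
      (hdxy ▸ Ne.symm hne) (hdxy ▸ hdα)
  rcases hle.eq_or_lt with heq₁ | hlt₁
  · exact hd.cornerPt_notMem h hdα ⟨hx.1.le, by linarith [hx.2]⟩ ⟨hy.1.le, by linarith [hy.2]⟩
      (hbxy ▸ hne) (hbxy ▸ hbα)
  exact hne (hb.eq_of_leftArm_lt h hbα hdα hd hlt₁ hlt₂)

lemma IsFineOptimal.dist_vertex_lt (h : IsFineOptimal n δ α) (hbα : b ∈ α)
    (hb : ServesCorner α b i) : dist (vertex (i + 1)) b < 2 * δ := by
  obtain ⟨x, hx, y, hy, hbxy⟩ := hb.exists_eq_cornerPt h.isOptimalMeans hbα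
  have hle : dist (vertex (i + 1)) b
      ≤ dist (cornerPt i (leftArm α b i) 0) (cornerPt i 0 (rightArm α b i)) := by
    refine le_of_sq_le_sq ?_ dist_nonneg
    nth_rw 1 [hbxy]
    rw [vertex_eq_cornerPt, dist_cornerPt_sq, dist_cornerPt_sq]
    nlinarith [mul_pos hx.1 hy.1, mul_pos hb.leftArm_pos hb.rightArm_pos, hx.1, hx.2, hy.1, hy.2]
  have htriangle := dist_triangle_right (cornerPt i (leftArm α b i) 0)
    (cornerPt i 0 (rightArm α b i)) b
  have hleft := h.dist_side_cellMean_lt hb.pos_left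
  have hright := h.dist_side_cellMean_lt hb.pos_right
  rw [side_cellMean] at hleft
  rw [side_succ_cellMean] at hright
  linarith

lemma exists_farSides_of_ne : ∀ i k : Fin 6, k ≠ i → k ≠ i + 1 →
    FarSides i k ∨ FarSides (i + 1) k := by decide

lemma IsFineOptimal.eq_or_eq_of_dist_vertex_lt (h : IsFineOptimal n δ α) (hδ : δ ≤ 1 / 24)
    (hd : dist (vertex (i + 1)) d < 2 * δ) {k : Fin 6} (hk : 0 < cellLength α d k) :
    k = i ∨ k = i + 1 := by
  by_contra! hne
  have hfar : 1 ≤ dist (vertex (i + 1)) (side k (cellMean α d k)) := by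
    have hmem := Set.Ioo_subset_Icc_self (cellMean_mem_Ioo hk)
    rcases exists_farSides_of_ne i k hne.1 hne.2 with hfar | hfar
    · have hone := hfar.one_le_dist (s := 1) (by simp) hmem
      rwa [side_eq_cornerPt, sub_self, ← vertex_eq_cornerPt] at hone
    · have hone := hfar.one_le_dist (s := 0) (by simp) hmem
      rwa [side_succ_eq_cornerPt, ← vertex_eq_cornerPt] at hone
  have htriangle := dist_triangle_right (vertex (i + 1)) (side k (cellMean α d k)) d
  linarith [h.dist_side_cellMean_lt hk]

lemma ServesCorner.dist_vertex_lt_of_servesOnly_left (h : IsOptimalMeans uniformDist n α)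
    (hbα : b ∈ α) (hb : ServesCorner α b i) (hdα : d ∈ α) (hd : ServesOnly α d i) (hdb : d ≠ b) :
    dist (vertex (i + 1)) b < dist (vertex (i + 1)) d := by
  by_contra! hle
  have hd' := hd.eq_side_cellMean h hdα
  rw [side_cellMean] at hd'
  have hpos : 0 < leftArm α d i := sub_pos.2 (cellMean_mem_Ioo hd.pos).2
  rcases le_or_gt (leftArm α d i) (leftArm α b i) with hle' | hlt
  · exact hb.cornerPt_notMem h hbα ⟨hpos.le, hle'⟩ ⟨le_rfl, hb.rightArm_pos.le⟩ (hd' ▸ hdb)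
      (hd' ▸ hdα)
  have hmem := cornerPt_zero_right_mem_segment (i := i) hb.leftArm_pos.le hlt.le hpos
  rw [← hd', segment_symm] at hmem
  refine (dist_lt_of_mem_segment ?_ hle hmem ?_).not_ge (hb.dist_leftArm_le hdα)
  · rw [dist_self]; exact dist_pos.2 hdb
  · rw [vertex_eq_cornerPt]; exact cornerPt_zero_right_ne hb.leftArm_pos.ne'

lemma ServesCorner.dist_vertex_lt_of_servesOnly_right (h : IsOptimalMeans uniformDist n α)
    (hbα : b ∈ α) (hb : ServesCorner α b i) (hdα : d ∈ α) (hd : ServesOnly α d (i + 1))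
    (hdb : d ≠ b) : dist (vertex (i + 1)) b < dist (vertex (i + 1)) d := by
  by_contra! hle
  have hd' := hd.eq_side_cellMean h hdα
  rw [side_succ_cellMean] at hd'
  have hpos : 0 < rightArm α d i := (cellMean_mem_Ioo hd.pos).1
  rcases le_or_gt (rightArm α d i) (rightArm α b i) with hle' | hlt
  · exact hb.cornerPt_notMem h hbα ⟨le_rfl, hb.leftArm_pos.le⟩ ⟨hpos.le, hle'⟩ (hd' ▸ hdb)
      (hd' ▸ hdα)
  have hmem := cornerPt_zero_left_mem_segment (i := i) hb.rightArm_pos.le hlt.le hpos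
  rw [← hd', segment_symm] at hmem
  refine (dist_lt_of_mem_segment ?_ hle hmem ?_).not_ge (hb.dist_rightArm_le hdα)
  · rw [dist_self]; exact dist_pos.2 hdb
  · rw [vertex_eq_cornerPt]; exact cornerPt_zero_left_ne hb.rightArm_pos.ne'

lemma eq_of_mem_pair_of_succ_mem_pair : ∀ i k : Fin 6, k = i ∨ k = i + 1 →
    k + 1 = i ∨ k + 1 = i + 1 → k = i := by decide

lemma IsFineOptimal.dist_vertex_lt_dist_vertex (h : IsFineOptimal n δ α) (hδ : δ ≤ 1 / 24)
    (hbα : b ∈ α) (hb : ServesCorner α b i) (hdα : d ∈ α) (hdb : d ≠ b) :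
    dist (vertex (i + 1)) b < dist (vertex (i + 1)) d := by
  by_contra! hle
  have hnear : ∀ {k}, 0 < cellLength α d k → k = i ∨ k = i + 1 :=
    h.eq_or_eq_of_dist_vertex_lt hδ (hle.trans_lt (h.dist_vertex_lt hbα hb))
  rcases h.servesOnly_or_servesCorner hδ hdα with ⟨j, hd⟩ | ⟨k, hd⟩
  · rcases hnear hd.pos with rfl | rfl
    · exact (hb.dist_vertex_lt_of_servesOnly_left h.isOptimalMeans hbα hdα hd hdb).not_ge hle
    · exact (hb.dist_vertex_lt_of_servesOnly_right h.isOptimalMeans hbα hdα hd hdb).not_ge hle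
  · obtain rfl := eq_of_mem_pair_of_succ_mem_pair i k (hnear hd.pos_left) (hnear hd.pos_right)
    exact hdb (hd.unique h.isOptimalMeans hdα hbα hb)

end ServesCorner

section ServedArms

lemma nearestPoint_eq_of_mem_segment {v p q b : Plane} (hα : α.Nonempty)
    (hv : ∀ d ∈ α, d ≠ b → dist v b < dist v d) (hq : nearestPoint α q = b)
    (hp : p ∈ segment ℝ v q) : nearestPoint α p = b := by
  by_contra hne
  have hbα : b ∈ α := hq ▸ nearestPoint_mem hα q
  have hdα := nearestPoint_mem hα p
  have hlt := dist_lt_of_mem_segment (hv _ hdα hne) (hq ▸ dist_nearestPoint_le q hdα) hp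
    (by rintro rfl; exact hne hq)
  exact hlt.not_ge (dist_nearestPoint_le p hbα)

lemma exists_threshold_of_forall_le_mem {A : Set ℝ} {c : ℝ} (hc : 0 ≤ c) (hA : A ⊆ Set.Icc 0 c)
    (hdown : ∀ t ∈ A, ∀ s, 0 ≤ s → s ≤ t → s ∈ A) :
    ∃ u ∈ Set.Icc 0 c, (∀ t, 0 ≤ t → t < u → t ∈ A) ∧ ∀ t, u < t → t ∉ A := by
  refine ⟨sSup A, ⟨Real.sSup_nonneg fun t ht => (hA ht).1, Real.sSup_le (fun t ht => (hA ht).2) hc⟩,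
    fun t ht htu => ?_, fun t hut ht => hut.not_ge (le_csSup ⟨c, fun s hs => (hA hs).2⟩ ht)⟩
  have hne : A.Nonempty := by
    rw [Set.nonempty_iff_ne_empty]
    rintro rfl
    rw [Real.sSup_empty] at htu
    exact htu.not_ge ht
  obtain ⟨s, hs, hts⟩ := exists_lt_of_lt_csSup hne htu
  exact hdown s hs t ht hts.le

lemma lineMap_mem_segment_lineMap (v w : Plane) {s t : ℝ} (hs : 0 ≤ s) (hst : s ≤ t) :
    AffineMap.lineMap v w s ∈ segment ℝ v (AffineMap.lineMap v w t) := by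
  rcases hs.eq_or_lt with rfl | hs
  · rw [AffineMap.lineMap_apply_zero]
    exact left_mem_segment ℝ v _
  have ht := hs.trans_le hst
  rw [segment_eq_image_lineMap]
  refine ⟨s / t, ⟨by positivity, (div_le_one ht).2 hst⟩, ?_⟩
  rw [AffineMap.lineMap_lineMap_right, div_mul_cancel₀ _ ht.ne']

lemma IsFineOptimal.exists_served_arm (h : IsFineOptimal n δ α) (hδ : δ ≤ 1 / 24) {i : Fin 6}
    {w : Plane} (hw : segment ℝ (vertex (i + 1)) w ⊆ boundary)
    (hdist : dist (vertex (i + 1)) w = 1) :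
    ∃ u ∈ Set.Icc (0 : ℝ) (1 / 8), ∀ t ∈ Set.Icc (0 : ℝ) 1,
      (t < u → ServesCorner α (nearestPoint α (AffineMap.lineMap (vertex (i + 1)) w t)) i) ∧
      (u < t → ¬ServesCorner α (nearestPoint α (AffineMap.lineMap (vertex (i + 1)) w t)) i) := by
  set γ : ℝ →ᵃ[ℝ] Plane := AffineMap.lineMap (vertex (i + 1)) w with hγ
  have hmem : ∀ t, nearestPoint α (γ t) ∈ α := fun t => nearestPoint_mem h.nonempty _
  have hboundary : ∀ t ∈ Set.Icc (0 : ℝ) 1, γ t ∈ boundary := fun t ht => hw (by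
    rw [segment_eq_image_lineMap]; exact ⟨t, ht, rfl⟩)
  set A : Set ℝ := {t ∈ Set.Icc 0 1 | ServesCorner α (nearestPoint α (γ t)) i}
  have hA : A ⊆ Set.Icc 0 (1 / 8) := fun t ⟨ht, hb⟩ => ⟨ht.1, by
    have htriangle := dist_triangle_right (vertex (i + 1)) (γ t) (nearestPoint α (γ t))
    rw [hγ, dist_left_lineMap, hdist, mul_one, Real.norm_of_nonneg ht.1, ← hγ] at htriangle
    linarith [h.dist_vertex_lt (hmem t) hb, h.dist_lt _ (hboundary t ht)]⟩
  have hdown : ∀ t ∈ A, ∀ s, 0 ≤ s → s ≤ t → s ∈ A := fun t ⟨ht, hb⟩ s hs hst =>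
    ⟨⟨hs, hst.trans ht.2⟩, by
      rwa [nearestPoint_eq_of_mem_segment h.nonempty
        (fun d hd hdb => h.dist_vertex_lt_dist_vertex hδ (hmem t) hb hd hdb) rfl
        (lineMap_mem_segment_lineMap _ w hs hst)]⟩
  obtain ⟨u, hu, hlt, hgt⟩ := exists_threshold_of_forall_le_mem (by norm_num) hA hdown
  exact ⟨u, hu, fun t ht => ⟨fun htu => (hlt t ht.1 htu).2, fun hut hb => hgt t hut ⟨ht, hb⟩⟩⟩

lemma dist_vertex_succ (j : Fin 6) : dist (vertex j) (vertex (j + 1)) = 1 := by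
  rw [dist_comm, dist_eq_norm, ← dir, norm_dir]

lemma segment_vertex_subset_boundary (j : Fin 6) :
    segment ℝ (vertex j) (vertex (j + 1)) ⊆ boundary :=
  Set.subset_iUnion (fun j : Fin 6 => segment ℝ (vertex j) (vertex (j + 1))) j

lemma IsFineOptimal.exists_served_start (h : IsFineOptimal n δ α) (hδ : δ ≤ 1 / 24) (i : Fin 6) :
    ∃ u ∈ Set.Icc (0 : ℝ) (1 / 8), ∀ t ∈ Set.Icc (0 : ℝ) 1,
      (t < u → ServesCorner α (nearestPoint α (side (i + 1) t)) i) ∧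
      (u < t → ¬ServesCorner α (nearestPoint α (side (i + 1) t)) i) :=
  h.exists_served_arm hδ (segment_vertex_subset_boundary (i + 1)) (dist_vertex_succ (i + 1))

lemma IsFineOptimal.exists_served_end (h : IsFineOptimal n δ α) (hδ : δ ≤ 1 / 24) (i : Fin 6) :
    ∃ v ∈ Set.Icc (7 / 8 : ℝ) 1, ∀ t ∈ Set.Icc (0 : ℝ) 1,
      (v < t → ServesCorner α (nearestPoint α (side i t)) i) ∧
      (t < v → ¬ServesCorner α (nearestPoint α (side i t)) i) := by
  obtain ⟨u, hu, hserved⟩ := h.exists_served_arm hδ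
    (by rw [segment_symm]; exact segment_vertex_subset_boundary i)
    (by rw [dist_comm]; exact dist_vertex_succ i)
  refine ⟨1 - u, ⟨by linarith [hu.2], by linarith [hu.1]⟩, fun t ht => ?_⟩
  have hreverse := hserved (1 - t) ⟨by linarith [ht.2], by linarith [ht.1]⟩
  rw [AffineMap.lineMap_apply_one_sub] at hreverse
  exact ⟨fun hlt => hreverse.1 (by linarith), fun hlt => hreverse.2 (by linarith)⟩

end ServedArms

variable {i j : Fin 6}

section PureMeans

open scoped Classical in
/-- The points of `α` that serve a part of positive length of the `j`th side and of no other
side. -/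
noncomputable def pureMeans (α : Finset Plane) (j : Fin 6) : Finset Plane :=
  {a ∈ α | ServesOnly α a j}

lemma mem_pureMeans {a : Plane} : a ∈ pureMeans α j ↔ a ∈ α ∧ ServesOnly α a j := by
  classical exact Finset.mem_filter

lemma pureMeans_subset (α : Finset Plane) (j : Fin 6) : pureMeans α j ⊆ α :=
  fun _ ha => (mem_pureMeans.1 ha).1

lemma disjoint_pureMeans (hij : i ≠ j) : Disjoint (pureMeans α i) (pureMeans α j) :=
  Finset.disjoint_left.2 fun _ hi hj =>
    (mem_pureMeans.1 hi).2.pos.ne' ((mem_pureMeans.1 hj).2.eq_zero i hij)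

lemma ServesOnly.not_servesCorner {a : Plane} (ha : ServesOnly α a j) : ¬ServesCorner α a i := by
  intro hcorner
  have hi : i = j := by_contra fun hne => hcorner.pos_left.ne' (ha.eq_zero i hne)
  have hsucc : i + 1 = j := by_contra fun hne => hcorner.pos_right.ne' (ha.eq_zero _ hne)
  simp [hi] at hsucc

/-- Up to null sets, the part of the `j`th side that corresponds to the parameters in `(u, v)` is
the part that is served by the points of `pureMeans α j`. -/
structure IsPureInterval (α : Finset Plane) (j : Fin 6) (u v : ℝ) : Prop where
  nonneg : 0 ≤ u
  le : u ≤ v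
  le_one : v ≤ 1
  null_of_notMem : ∀ a ∈ α, a ∉ pureMeans α j → volume (Set.Ioo u v ∩ cell α a j) = 0
  null_of_mem : ∀ a ∈ pureMeans α j, volume (cell α a j \ Set.Ioo u v) = 0

lemma IsPureInterval.Ioo_subset {u v : ℝ} (h : IsPureInterval α j u v) :
    Set.Ioo u v ⊆ Set.Icc 0 1 :=
  fun _ ht => ⟨h.nonneg.trans ht.1.le, ht.2.le.trans h.le_one⟩

lemma IsFineOptimal.volume_inter_cell_eq_zero (h : IsFineOptimal n δ α) (hδ : δ ≤ 1 / 24)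
    {s : Set ℝ} (hs : ∀ t ∈ s, ¬ServesCorner α (nearestPoint α (side (i + 1) t)) i ∧
      ¬ServesCorner α (nearestPoint α (side (i + 1) t)) (i + 1)) {a : Plane} (ha : a ∈ α)
    (hpure : a ∉ pureMeans α (i + 1)) : volume (s ∩ cell α a (i + 1)) = 0 := by
  rcases (cellLength_nonneg α a (i + 1)).eq_or_lt with hlen | hlen
  · exact measure_mono_null Set.inter_subset_right (volume_cell_eq_zero hlen.symm)
  rcases h.servesOnly_or_servesCorner hδ ha with ⟨k, hk⟩ | ⟨k, hk⟩
  · obtain rfl : i + 1 = k := by_contra fun hne => hlen.ne' (hk.eq_zero _ hne)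
    exact absurd (mem_pureMeans.2 ⟨ha, hk⟩) hpure
  · have hki : k = i + 1 ∨ k = i := by
      by_contra! hne
      exact hlen.ne' (hk.eq_zero _ hne.1.symm fun heq => hne.2 (add_right_cancel heq).symm)
    have hempty : s ∩ cell α a (i + 1) = ∅ := Set.eq_empty_iff_forall_notMem.2 fun t ht => by
      have hnot := hs t ht.1
      rw [ht.2.2] at hnot
      rcases hki with rfl | rfl
      exacts [hnot.2 hk, hnot.1 hk]
    rw [hempty, measure_empty]

lemma IsFineOptimal.isPureInterval (h : IsFineOptimal n δ α) (hδ : δ ≤ 1 / 24) {u v : ℝ}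
    (hu : 0 ≤ u) (huv : u ≤ v) (hv : v ≤ 1)
    (hstart : ∀ t ∈ Set.Icc (0 : ℝ) 1,
      (t < u → ServesCorner α (nearestPoint α (side (i + 1) t)) i) ∧
      (u < t → ¬ServesCorner α (nearestPoint α (side (i + 1) t)) i))
    (hend : ∀ t ∈ Set.Icc (0 : ℝ) 1,
      (v < t → ServesCorner α (nearestPoint α (side (i + 1) t)) (i + 1)) ∧
      (t < v → ¬ServesCorner α (nearestPoint α (side (i + 1) t)) (i + 1))) :
    IsPureInterval α (i + 1) u v where
  nonneg := hu
  le := huv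
  le_one := hv
  null_of_notMem a ha hpure := h.volume_inter_cell_eq_zero hδ (fun t ht =>
    have ht01 : t ∈ Set.Icc (0 : ℝ) 1 := ⟨hu.trans ht.1.le, ht.2.le.trans hv⟩
    ⟨(hstart t ht01).2 ht.1, (hend t ht01).2 ht.2⟩) ha hpure
  null_of_mem a ha := by
    refine measure_mono_null (t := {u, v}) ?_ ((Set.toFinite _).measure_zero volume)
    rintro t ⟨⟨ht01, hta⟩, ht⟩
    have hnot : ∀ {k}, ¬ServesCorner α (nearestPoint α (side (i + 1) t)) k := by
      rw [hta]
      exact (mem_pureMeans.1 ha).2.not_servesCorner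
    have hut : u ≤ t := not_lt.1 fun hlt => hnot ((hstart t ht01).1 hlt)
    have htv : t ≤ v := not_lt.1 fun hlt => hnot ((hend t ht01).1 hlt)
    by_contra! hne
    simp only [Set.mem_insert_iff, Set.mem_singleton_iff, not_or] at hne
    exact ht ⟨hut.lt_of_ne' hne.1, htv.lt_of_ne hne.2⟩

end PureMeans

section LowerBound

variable {s : Set ℝ} {M : Finset Plane}

lemma eq_biUnion_inter_cell (hα : α.Nonempty) (j : Fin 6) (hs : s ⊆ Set.Icc 0 1) :
    s = ⋃ a ∈ α, s ∩ cell α a j := by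
  ext t
  simp only [Set.mem_iUnion, exists_prop]
  exact ⟨fun ht => ⟨_, nearestPoint_mem hα _, ht, hs ht, rfl⟩, fun ⟨_, _, ht, _⟩ => ht⟩

lemma pairwiseDisjoint_inter_cell (α : Finset Plane) (j : Fin 6) (s : Set ℝ) :
    (α : Set Plane).PairwiseDisjoint fun a => s ∩ cell α a j :=
  fun _ _ _ _ hab => Set.disjoint_left.2 fun _ ht ht' => hab (ht.2.2.symm.trans ht'.2.2)

lemma isBounded_inter_cell (s : Set ℝ) (α : Finset Plane) (a : Plane) (j : Fin 6) :
    Bornology.IsBounded (s ∩ cell α a j) :=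
  (isBounded_cell α a j).subset Set.inter_subset_right

lemma sum_volume_inter_cell (hα : α.Nonempty) (hsm : MeasurableSet s) (hs : s ⊆ Set.Icc 0 1)
    (hM : M ⊆ α) (hnull : ∀ a ∈ α, a ∉ M → volume (s ∩ cell α a j) = 0) :
    ∑ a ∈ M, volume.real (s ∩ cell α a j) = volume.real s := by
  rw [Finset.sum_subset hM fun a ha haM => by rw [measureReal_def, hnull a ha haM,
      ENNReal.toReal_zero],
    ← measureReal_biUnion_finset (pairwiseDisjoint_inter_cell α j s)
      (fun a _ => hsm.inter (measurableSet_cell α a j))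
      (fun a _ => (isBounded_inter_cell s α a j).measure_lt_top.ne),
    ← eq_biUnion_inter_cell hα j hs]

lemma sum_setIntegral_inter_cell (hα : α.Nonempty) (hsm : MeasurableSet s)
    (hs : s ⊆ Set.Icc 0 1) :
    ∑ a ∈ α, ∫ t in s ∩ cell α a j, dist (side j t) a ^ 2
      = ∫ t in s, dist (side j t) (nearestPoint α (side j t)) ^ 2 := by
  have hmeas : ∀ a, MeasurableSet (s ∩ cell α a j) := fun a =>
    hsm.inter (measurableSet_cell α a j)
  conv_rhs => rw [eq_biUnion_inter_cell hα j hs]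
  rw [integral_biUnion_finset α (fun a _ => hmeas a) (pairwiseDisjoint_inter_cell α j s)
    fun a _ => (integrableOn_dist_sq_nearestPoint_side hα j).mono_set
      (Set.inter_subset_left.trans hs)]
  exact Finset.sum_congr rfl fun a _ =>
    setIntegral_congr_fun (hmeas a) fun t ht => by simp only [ht.2.2]

lemma IsFineOptimal.volume_le_card_mul (h : IsFineOptimal n δ α) (hδ : 0 ≤ δ)
    (hsm : MeasurableSet s) (hs : s ⊆ Set.Icc 0 1) (hM : M ⊆ α)
    (hnull : ∀ a ∈ α, a ∉ M → volume (s ∩ cell α a j) = 0) :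
    volume.real s ≤ M.card * (2 * δ) := by
  rw [← sum_volume_inter_cell h.nonempty hsm hs hM hnull, ← nsmul_eq_mul]
  exact Finset.sum_le_card_nsmul _ _ _ fun a _ =>
    (measureReal_mono Set.inter_subset_right (volume_cell_ne_top α a j)).trans
      (h.cellLength_le hδ a j)

lemma pow_three_div_le_setIntegral (hα : α.Nonempty) (hsm : MeasurableSet s)
    (hs : s ⊆ Set.Icc 0 1) (hM : M ⊆ α)
    (hnull : ∀ a ∈ α, a ∉ M → volume (s ∩ cell α a j) = 0) :
    volume.real s ^ 3 / (12 * M.card ^ 2)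
      ≤ ∫ t in s, dist (side j t) (nearestPoint α (side j t)) ^ 2 := by
  rcases M.card.eq_zero_or_pos with hm | hm
  · simpa [hm] using integral_nonneg fun _ => sq_nonneg _
  have hm' : (M.card : ℝ) ≠ 0 := by positivity
  set r := volume.real s / (2 * M.card) with hr
  calc volume.real s ^ 3 / (12 * M.card ^ 2)
      = ∑ a ∈ M, (r ^ 2 * volume.real (s ∩ cell α a j) - 4 * r ^ 3 / 3) := by
        rw [Finset.sum_sub_distrib, ← Finset.mul_sum, sum_volume_inter_cell hα hsm hs hM hnull,
          Finset.sum_const, nsmul_eq_mul, hr]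
        field_simp
        ring
    _ ≤ ∑ a ∈ M, ∫ t in s ∩ cell α a j, dist (side j t) a ^ 2 := Finset.sum_le_sum fun a _ =>
        le_setIntegral_dist_sq_affineIsometry (side j) (isBounded_inter_cell s α a j) a
          (by positivity)
    _ ≤ ∑ a ∈ α, ∫ t in s ∩ cell α a j, dist (side j t) a ^ 2 :=
        Finset.sum_le_sum_of_subset_of_nonneg hM fun _ _ _ => integral_nonneg fun _ => sq_nonneg _
    _ = ∫ t in s, dist (side j t) (nearestPoint α (side j t)) ^ 2 :=
        sum_setIntegral_inter_cell hα hsm hs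

lemma IsPureInterval.pow_three_div_le {u v : ℝ} (h : IsPureInterval α j u v) (hα : α.Nonempty) :
    (v - u) ^ 3 / (12 * (pureMeans α j).card ^ 2)
      ≤ ∫ t in Set.Ioo u v, dist (side j t) (nearestPoint α (side j t)) ^ 2 := by
  rw [← Real.volume_real_Ioo_of_le h.le]
  exact pow_three_div_le_setIntegral hα measurableSet_Ioo h.Ioo_subset (pureMeans_subset α j)
    h.null_of_notMem

lemma IsPureInterval.eleven_le_card {u v : ℝ} (hj : IsPureInterval α j u v)
    (h : IsFineOptimal n δ α) (hδ0 : 0 ≤ δ) (hδ : δ ≤ 1 / 24) (hlen : 7 / 8 ≤ v - u) :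
    11 ≤ (pureMeans α j).card := by
  have hle := h.volume_le_card_mul hδ0 measurableSet_Ioo hj.Ioo_subset (pureMeans_subset α j)
    hj.null_of_notMem
  rw [Real.volume_real_Ioo_of_le hj.le] at hle
  have hδcard : ((pureMeans α j).card : ℝ) * (2 * δ) ≤ (pureMeans α j).card * (1 / 12) := by
    gcongr
    linarith
  have hlt : (10 : ℝ) < (pureMeans α j).card := by linarith
  exact_mod_cast hlt

end LowerBound

section Competitor

lemma IsPureInterval.add_le_of_hasQuantizer {u v u' v' c d : ℝ}
    {S T : Finset Plane} (hi : IsPureInterval α i u v) (hj : IsPureInterval α j u' v')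
    (hij : i ≠ j) (h : IsOptimalMeans uniformDist n α) (hα : α.Nonempty)
    (hcard : (S ∪ T).card ≤ (pureMeans α i).card + (pureMeans α j).card)
    (hS : HasQuantizer (side i) S u v c) (hT : HasQuantizer (side j) T u' v' d) :
    (v - u) ^ 3 / (12 * (pureMeans α i).card ^ 2)
      + (v' - u') ^ 3 / (12 * (pureMeans α j).card ^ 2) ≤ c + d := by
  obtain ⟨f, hf, hfS, rfl⟩ := hS
  obtain ⟨g, hg, hgT, rfl⟩ := hT
  set I : Fin 6 → Set ℝ :=
    fun k => if k = i then Set.Ioo u v else if k = j then Set.Ioo u' v' else ∅ with hI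
  set q : Fin 6 → ℝ → Plane := fun k => if k = i then f else g with hq
  have hIi : I i = Set.Ioo u v := if_pos rfl
  have hIj : I j = Set.Ioo u' v' := (if_neg hij.symm).trans (if_pos rfl)
  have hqi : q i = f := if_pos rfl
  have hqj : q j = g := if_neg hij.symm
  have hIempty : ∀ k, k ≠ i ∧ k ≠ j → I k = ∅ := fun k hk =>
    (if_neg hk.1).trans (if_neg hk.2)
  have hserved : ∀ k, ∀ a ∈ pureMeans α i ∪ pureMeans α j, volume (cell α a k \ I k) = 0 := by
    have hnull : ∀ {l}, (∀ a ∈ pureMeans α l, volume (cell α a l \ I l) = 0) →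
        ∀ k, ∀ a ∈ pureMeans α l, volume (cell α a k \ I k) = 0 := fun {l} hl k a ha => by
      rcases eq_or_ne k l with rfl | hk
      · exact hl a ha
      · exact measure_mono_null Set.sdiff_subset
          (volume_cell_eq_zero ((mem_pureMeans.1 ha).2.eq_zero k hk))
    exact fun k a ha => (Finset.mem_union.1 ha).elim
      (hnull (by rw [hIi]; exact hi.null_of_mem) k a)
      (hnull (by rw [hIj]; exact hj.null_of_mem) k a)
  have hcost := h.sum_setIntegral_le_of_replace (S := S ∪ T) hα
    (Finset.union_subset (pureMeans_subset α i) (pureMeans_subset α j))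
    (by rwa [Finset.card_union_of_disjoint (disjoint_pureMeans hij)])
    (fun k => by simp only [hI]; split_ifs <;> measurability)
    (fun k => by simp only [hI]; split_ifs; exacts [hi.Ioo_subset, hj.Ioo_subset, by simp])
    hserved (g := q) (fun k => by simp only [hq]; split_ifs <;> assumption)
    (fun k t => by
      simp only [hq]; split_ifs; exacts [Finset.mem_union_left _ (Finset.mem_union_left _ (hfS t)),
        Finset.mem_union_left _ (Finset.mem_union_right _ (hgT t))])
  rw [Fintype.sum_eq_add i j hij fun k hk => by rw [hIempty k hk, setIntegral_empty],
    Fintype.sum_eq_add i j hij fun k hk => by rw [hIempty k hk, setIntegral_empty],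
    hIi, hIj, hqi, hqj] at hcost
  rw [intervalIntegral.integral_of_le hi.le, intervalIntegral.integral_of_le hj.le,
    integral_Ioc_eq_integral_Ioo, integral_Ioc_eq_integral_Ioo]
  exact (add_le_add (hi.pow_three_div_le hα) (hj.pow_three_div_le hα)).trans hcost

lemma integral_sq_sub_mul_add (c : ℝ) :
    ∫ t in (0 : ℝ)..c, (t ^ 2 - c / 4 * t + c ^ 2 / 16) = 13 * c ^ 3 / 48 := by
  rw [intervalIntegral.integral_add (Continuous.intervalIntegrable (by fun_prop) _ _) (by simp),
    intervalIntegral.integral_sub (by simp) (Continuous.intervalIntegrable (by fun_prop) _ _),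
    intervalIntegral.integral_const, intervalIntegral.integral_const_mul, integral_id,
    integral_pow]
  simp only [smul_eq_mul]
  push_cast
  ring

lemma hasQuantizer_cornerPt_right (i : Fin 6) (c : ℝ) :
    HasQuantizer (cornerPt i 0) {cornerPt i (c / 4) (c / 4)} 0 c (13 * c ^ 3 / 48) := by
  have hquant := hasQuantizer_singleton (cornerPt i 0) (cornerPt i (c / 4) (c / 4)) 0 c
  simp only [dist_cornerPt_sq] at hquant
  convert hquant using 1
  rw [← integral_sq_sub_mul_add]
  congr with t
  ring

lemma hasQuantizer_cornerPt_left (i : Fin 6) (c : ℝ) :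
    HasQuantizer (fun t => cornerPt i t 0) {cornerPt i (c / 4) (c / 4)} 0 c (13 * c ^ 3 / 48) := by
  have hquant := hasQuantizer_singleton (fun t => cornerPt i t 0) (cornerPt i (c / 4) (c / 4)) 0 c
  simp only [dist_cornerPt_sq] at hquant
  convert hquant using 1
  rw [← integral_sq_sub_mul_add]
  congr with t
  ring

lemma exists_hasQuantizer_start (i : Fin 6) {v c : ℝ} (hc : 0 ≤ c)
    (hcv : c ≤ v) {k : ℕ} (hk : k ≠ 0) : ∃ S : Finset Plane, S.card ≤ k ∧
      HasQuantizer (side (i + 1)) ({cornerPt i (c / 4) (c / 4)} ∪ S) 0 v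
        (13 * c ^ 3 / 48 + (v - c) ^ 3 / (12 * k ^ 2)) := by
  obtain ⟨S, hcard, hS⟩ := exists_hasQuantizer_card_le (side (i + 1)) hcv hk
  have hcorner := hasQuantizer_cornerPt_right i c
  rw [← funext (side_succ_eq_cornerPt i)] at hcorner
  exact ⟨S, hcard, hcorner.union (side (i + 1)).continuous hS hc hcv⟩

lemma exists_hasQuantizer_end (i : Fin 6) {u c : ℝ} (hc : 0 ≤ c)
    (huc : u ≤ 1 - c) {k : ℕ} (hk : k ≠ 0) : ∃ S : Finset Plane, S.card ≤ k ∧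
      HasQuantizer (side i) (S ∪ {cornerPt i (c / 4) (c / 4)}) u 1
        ((1 - u - c) ^ 3 / (12 * k ^ 2) + 13 * c ^ 3 / 48) := by
  obtain ⟨S, hcard, hS⟩ := exists_hasQuantizer_card_le (side i) huc hk
  have hcorner := (hasQuantizer_cornerPt_left i c).comp_one_sub
  rw [← funext (side_eq_cornerPt i), sub_zero] at hcorner
  rw [sub_right_comm]
  exact ⟨S, hcard, hS.union (side i).continuous hcorner huc (by linarith)⟩

lemma IsPureInterval.add_le_of_corner {u v c : ℝ} {k l : ℕ} (hi : IsPureInterval α i u 1)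
    (hj : IsPureInterval α (i + 1) 0 v) (h : IsOptimalMeans uniformDist n α) (hα : α.Nonempty)
    (hc : 0 ≤ c) (huc : u ≤ 1 - c) (hcv : c ≤ v) (hk : k ≠ 0) (hl : l ≠ 0)
    (hcard : k + l + 1 ≤ (pureMeans α i).card + (pureMeans α (i + 1)).card) :
    (1 - u) ^ 3 / (12 * (pureMeans α i).card ^ 2) + v ^ 3 / (12 * (pureMeans α (i + 1)).card ^ 2)
      ≤ ((1 - u - c) ^ 3 / (12 * k ^ 2) + 13 * c ^ 3 / 48)
        + (13 * c ^ 3 / 48 + (v - c) ^ 3 / (12 * l ^ 2)) := by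
  obtain ⟨S, hScard, hS⟩ := exists_hasQuantizer_end i hc huc hk
  obtain ⟨T, hTcard, hT⟩ := exists_hasQuantizer_start i hc hcv hl
  have hle := hi.add_le_of_hasQuantizer hj (by simp) h hα (S := S ∪ {cornerPt i (c / 4) (c / 4)})
    (T := {cornerPt i (c / 4) (c / 4)} ∪ T) ?_ hS hT
  · rwa [sub_zero] at hle
  · rw [← Finset.union_assoc, Finset.union_assoc S, Finset.union_idempotent]
    have hunion := Finset.card_union_le (S ∪ {cornerPt i (c / 4) (c / 4)}) T
    have hunion' := Finset.card_union_le S {cornerPt i (c / 4) (c / 4)}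
    rw [Finset.card_singleton] at hunion'
    omega

end Competitor

section CornerMeans

variable {m k a l : ℝ}

lemma le_cost_sub_cost_shortened (hm : 11 ≤ m) (hl : 0 ≤ l) (hla : l ≤ a) :
    63 / 44 * l ^ 3 / 12 ≤ (m * a) ^ 3 / (12 * m ^ 2) - (m * a - l / 2) ^ 3 / (12 * m ^ 2) := by
  have hm0 : 0 < m := by linarith
  have ha := hl.trans hla
  have hexpand : (m * a) ^ 3 / (12 * m ^ 2) - (m * a - l / 2) ^ 3 / (12 * m ^ 2)
      = (3 / 2 * (a ^ 2 * l) - 3 / 4 * (a * l ^ 2) * m⁻¹ + l ^ 3 / 8 * m⁻¹ ^ 2) / 12 := by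
    field_simp
    ring
  have hinv : m⁻¹ ≤ 1 / 11 := by rw [inv_eq_one_div]; gcongr
  have hcross : 3 / 4 * (a * l ^ 2) * m⁻¹ ≤ 3 / 4 * (a ^ 2 * l) * (1 / 11) := by
    gcongr ?_ * ?_
    nlinarith [mul_nonneg ha hl]
  have hcube : l ^ 3 ≤ a ^ 2 * l := by
    rw [pow_succ]; gcongr
  have hsq : 0 ≤ l ^ 3 / 8 * m⁻¹ ^ 2 := by positivity
  rw [hexpand]
  linarith

lemma cost_sub_cost_removed_le (hk : 11 ≤ k) (hl : 0 ≤ l) :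
    (k * l - l / 2) ^ 3 / (12 * (k - 1) ^ 2) - (k * l) ^ 3 / (12 * k ^ 2)
      ≤ 461 / 800 * l ^ 3 / 12 := by
  have hk0 : 0 < k := by linarith
  have hk1 : 0 < k - 1 := by linarith
  have hexpand : (k * l - l / 2) ^ 3 / (12 * (k - 1) ^ 2) - (k * l) ^ 3 / (12 * k ^ 2)
      = l ^ 3 * (1 / 2 + 3 / 4 * (k - 1)⁻¹ + (k - 1)⁻¹ ^ 2 / 8) / 12 := by
    field_simp
    ring
  have hinv : (k - 1)⁻¹ ≤ 1 / 10 := by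
    rw [inv_eq_one_div]
    gcongr
    linarith
  calc _ = l ^ 3 * (1 / 2 + 3 / 4 * (k - 1)⁻¹ + (k - 1)⁻¹ ^ 2 / 8) / 12 := hexpand
    _ ≤ l ^ 3 * (1 / 2 + 3 / 4 * (1 / 10) + (1 / 10) ^ 2 / 8) / 12 := by gcongr
    _ = 461 / 800 * l ^ 3 / 12 := by ring

/- One of the `k` cells of length `l` is given up, and a corner point takes over an arm of length
`l / 2` on either side of the vertex. In units of `l ^ 3 / 12`, the shortening of the other side
gains at least `63 / 44`, the lost cell costs at most `461 / 800`, and the corner point costs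
`13 / 16`. -/
lemma cost_with_corner_lt (hm : 11 ≤ m) (hk : 11 ≤ k) (hl : 0 < l) (hla : l ≤ a) :
    (m * a - l / 2) ^ 3 / (12 * m ^ 2) + 13 * (l / 2) ^ 3 / 48
        + (13 * (l / 2) ^ 3 / 48 + (k * l - l / 2) ^ 3 / (12 * (k - 1) ^ 2))
      < (m * a) ^ 3 / (12 * m ^ 2) + (k * l) ^ 3 / (12 * k ^ 2) := by
  have hgain := le_cost_sub_cost_shortened hm hl.le hla
  have hloss := cost_sub_cost_removed_le hk hl.le
  linarith [pow_pos hl 3]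

lemma cell_length_half_le {T : ℝ} {k : ℕ} (hT : T ≤ 1) (hk : 11 ≤ k) : T / k / 2 ≤ 1 / 22 := by
  have hk' : (11 : ℝ) ≤ k := by exact_mod_cast hk
  rw [div_div, div_le_div_iff₀ (by positivity) (by norm_num)]
  linarith

lemma IsPureInterval.false_of_adjacent {u v : ℝ} (hi : IsPureInterval α i u 1)
    (hj : IsPureInterval α (i + 1) 0 v) (h : IsFineOptimal n δ α) (hδ0 : 0 ≤ δ)
    (hδ : δ ≤ 1 / 24) (hu : u ≤ 1 / 8) (hv : 7 / 8 ≤ v) : False := by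
  have hm := hi.eleven_le_card h hδ0 hδ (by linarith)
  have hk := hj.eleven_le_card h hδ0 hδ (by linarith)
  have hcorner := fun c k l => hi.add_le_of_corner hj (c := c) (k := k) (l := l)
    h.isOptimalMeans h.nonempty
  set m := (pureMeans α i).card
  set k := (pureMeans α (i + 1)).card
  have hm' : (11 : ℝ) ≤ m := by exact_mod_cast hm
  have hk' : (11 : ℝ) ≤ k := by exact_mod_cast hk
  have hu1 : 0 < (1 - u) / m := div_pos (by linarith) (by linarith)
  have hv0 : 0 < v / k := div_pos (by linarith) (by linarith)
  have hma : m * ((1 - u) / m) = 1 - u := mul_div_cancel₀ _ (by linarith)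
  have hkl : k * (v / k) = v := mul_div_cancel₀ _ (by linarith)
  rcases le_total (v / k) ((1 - u) / m) with hle | hle
  · have hshort := cell_length_half_le hj.le_one hk
    have hcost := hcorner (v / k / 2) m (k - 1) (by linarith) (by linarith)
      (by linarith) (by omega) (by omega) (by omega)
    have hlt := cost_with_corner_lt hm' hk' hv0 hle
    rw [hma, hkl] at hlt
    rw [Nat.cast_sub (by omega), Nat.cast_one] at hcost
    exact hlt.not_ge hcost
  · have hshort := cell_length_half_le (T := 1 - u) (by linarith [hi.nonneg]) hm
    have hcost := hcorner ((1 - u) / m / 2) (m - 1) k (by linarith) (by linarith)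
      (by linarith) (by omega) (by omega) (by omega)
    have hlt := cost_with_corner_lt hk' hm' hu1 hle
    rw [hma, hkl] at hlt
    rw [Nat.cast_sub (by omega), Nat.cast_one] at hcost
    linarith

lemma IsFineOptimal.exists_servesCorner (h : IsFineOptimal n δ α) (hδ0 : 0 ≤ δ)
    (hδ : δ ≤ 1 / 24) (i : Fin 6) : ∃ a ∈ α, ServesCorner α a i := by
  by_contra! hno
  obtain ⟨i, rfl⟩ : ∃ i', i = i' + 1 := ⟨i - 1, (sub_add_cancel i 1).symm⟩
  have hnone : ∀ p, ¬ServesCorner α (nearestPoint α p) (i + 1) := fun p =>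
    hno _ (nearestPoint_mem h.nonempty p)
  obtain ⟨u, hu, hstart⟩ := h.exists_served_start hδ i
  obtain ⟨v, hv, hend⟩ := h.exists_served_end hδ (i + 1 + 1)
  have hleft : IsPureInterval α (i + 1) u 1 :=
    h.isPureInterval hδ hu.1 (by linarith [hu.2]) le_rfl hstart
      fun t ht => ⟨fun hlt => absurd ht.2 hlt.not_ge, fun _ => hnone _⟩
  have hright : IsPureInterval α (i + 1 + 1) 0 v :=
    h.isPureInterval hδ le_rfl (by linarith [hv.1]) hv.2
      (fun t ht => ⟨fun hlt => absurd ht.1 hlt.not_ge, fun _ => hnone _⟩) hend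
  exact hleft.false_of_adjacent hright h hδ0 hδ hu.2 hv.1

end CornerMeans

open Classical in
/-- The corner point `c_i(α)`: the point of `α` that serves both sides meeting at the `i`th vertex,
with the junk value `0` if there is none. -/
noncomputable def cornerPoint (α : Finset Plane) (i : Fin 6) : Plane :=
  if h : ∃ a ∈ α, ServesCorner α a (i - 1) then h.choose else 0

lemma IsFineOptimal.cornerPoint_spec (h : IsFineOptimal n δ α) (hδ0 : 0 ≤ δ) (hδ : δ ≤ 1 / 24)
    (i : Fin 6) : cornerPoint α i ∈ α ∧ ServesCorner α (cornerPoint α i) (i - 1) := by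
  have hex := h.exists_servesCorner hδ0 hδ (i - 1)
  rw [cornerPoint, dif_pos hex]
  exact hex.choose_spec

lemma IsFineOptimal.dist_cornerPoint_lt (h : IsFineOptimal n δ α) (hδ0 : 0 ≤ δ)
    (hδ : δ ≤ 1 / 24) (i : Fin 6) : dist (cornerPoint α i) (vertex i) < 2 * δ := by
  obtain ⟨hmem, hserves⟩ := h.cornerPoint_spec hδ0 hδ i
  have hdist := h.dist_vertex_lt hmem hserves
  rwa [sub_add_cancel, dist_comm] at hdist

lemma ServesCorner.mem_interior_region {a : Plane} (hi : ServesCorner α a i)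
    (h : IsFineOptimal n δ α) (hδ : δ ≤ 1 / 24) (ha : a ∈ α) : a ∈ interior region := by
  obtain ⟨x, hx, y, hy, hxy⟩ := hi.exists_eq_cornerPt h.isOptimalMeans ha
  have hdist : dist (vertex (i + 1)) a < 1 / 12 :=
    (h.dist_vertex_lt ha hi).trans_le (by linarith)
  have hsq : dist (vertex (i + 1)) a ^ 2 < (1 / 12) ^ 2 := by gcongr
  rw [hxy, vertex_eq_cornerPt, dist_cornerPt_sq] at hsq
  rw [hxy]
  exact cornerPt_mem_interior_region i hx.1 hy.1 (by nlinarith [sq_nonneg (x - y)])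

lemma ServesCorner.index_unique {a : Plane} (hi : ServesCorner α a i) (hj : ServesCorner α a j) :
    i = j := by
  by_contra! hne
  by_cases hsucc : j = i + 1
  · subst hsucc
    exact hj.pos_right.ne' (hi.eq_zero _ (by clear * -; decide +revert) (by simp))
  · exact hj.pos_left.ne' (hi.eq_zero j hne.symm hsucc)

lemma IsFineOptimal.injective_cornerPoint (h : IsFineOptimal n δ α) (hδ0 : 0 ≤ δ)
    (hδ : δ ≤ 1 / 24) : Function.Injective (cornerPoint α) := fun i j hij => by
  have hi := (h.cornerPoint_spec hδ0 hδ i).2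
  rw [hij] at hi
  exact sub_left_injective (hi.index_unique (h.cornerPoint_spec hδ0 hδ j).2)

lemma IsFineOptimal.mem_boundary_of_notMem_range (h : IsFineOptimal n δ α) (hδ0 : 0 ≤ δ)
    (hδ : δ ≤ 1 / 24) {a : Plane} (ha : a ∈ α) (hrange : a ∉ Set.range (cornerPoint α)) :
    a ∈ boundary := by
  rcases h.servesOnly_or_servesCorner hδ ha with ⟨j, hj⟩ | ⟨i, hi⟩
  · rw [hj.eq_side_cellMean h.isOptimalMeans ha]
    exact side_mem_boundary j (cellMean_mem_Icc hj.pos)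
  · refine absurd ⟨i + 1, ?_⟩ hrange
    obtain ⟨hmem, hserves⟩ := h.cornerPoint_spec hδ0 hδ (i + 1)
    rw [add_sub_cancel_right] at hserves
    exact hserves.unique h.isOptimalMeans hmem ha hi

end HexQuant

theorem mainTheorem8 :
    ∃ (N : ℕ) (corner : Finset HexQuant.Plane → Fin 6 → HexQuant.Plane),
      (∀ n : ℕ, N ≤ n → ∀ α : Finset HexQuant.Plane,
        HexQuant.IsOptimalMeans HexQuant.uniformDist n α →
          Function.Injective (corner α) ∧
          (∀ i : Fin 6, corner α i ∈ α ∧ corner α i ∈ interior HexQuant.region) ∧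
          (∀ x ∈ α, x ∉ Set.range (corner α) → x ∈ HexQuant.boundary)) ∧
      (∀ ε : ℝ, 0 < ε → ∃ M : ℕ, ∀ n : ℕ, M ≤ n → ∀ α : Finset HexQuant.Plane,
        HexQuant.IsOptimalMeans HexQuant.uniformDist n α →
          ∀ i : Fin 6, dist (corner α i) (HexQuant.vertex i) < ε) := by
  obtain ⟨N, hN⟩ := HexQuant.exists_isFineOptimal (δ := 1 / 24) (by norm_num) (by norm_num)
  refine ⟨N, HexQuant.cornerPoint, fun n hn α hα => ?_, fun ε hε => ?_⟩
  · have hfine := hN n hn α hα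
    have hspec := hfine.cornerPoint_spec (by norm_num) le_rfl
    exact ⟨hfine.injective_cornerPoint (by norm_num) le_rfl,
      fun i => ⟨(hspec i).1, (hspec i).2.mem_interior_region hfine le_rfl (hspec i).1⟩,
      fun x hx => hfine.mem_boundary_of_notMem_range (by norm_num) le_rfl hx⟩
  · set δ := min (1 / 24) (ε / 2)
    have hδ0 : 0 < δ := by positivity
    have hδ : δ ≤ 1 / 24 := min_le_left _ _
    obtain ⟨M, hM⟩ := HexQuant.exists_isFineOptimal hδ0 (by linarith)
    refine ⟨M, fun n hn α hα i => ?_⟩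
    calc dist (HexQuant.cornerPoint α i) (HexQuant.vertex i)
        < 2 * δ := (hM n hn α hα).dist_cornerPoint_lt hδ0.le hδ i
      _ ≤ ε := by linarith [min_le_right (1 / 24) (ε / 2)]
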